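/- **Theorem (Local Abstract Makeenko–Migdal Equation).** Let $K$ be a compact Lie group with Lie algebra $\mathfrak k$, equipped with a bi-invariant Riemannian metric, and let $dx$ be the normalized Haar measure on $K$. Let $\Delta=\sum_X \hat X^2$ be the Laplacian of the metric, where $X$ runs over an orthonormal basis of $\mathfrak k$ and $(\hat X u)(x)=\frac{d}{ds}u(xe^{sX})|_{s=0}$. Let $(\rho_t)_{t>0}$ be the heat kernel of $K$, i.e. $\rho_t(x)$ is real-valued and smooth in $(t,x)\in(0,\infty)\times K$, satisfies $\frac{\partial\rho_t}{\partial t}=\frac12\Delta\rho_t$, and $\lim_{t\to0^+}\int_K u(x)\rho_t(x)\,dx=u(\mathrm{id})$ for every continuous $u$ on $K$. Suppose $f:K^4\to\mathbb C$ is a smooth function with the extended gauge invariance property $$f(a_1,a_2,a_3,a_4)=f(a_1x,a_2,a_3x,a_4)=f(a_1,a_2x,a_3,a_4x)\qquad\text{for all } (a_1,a_2,a_3,a_4)\in K^4,\ x\in K.$$ For $\alpha=(\alpha_1,\dots,\alpha_4)\in K^4$ and $\mathbf t=(t_1,\dots,t_4)\in(0,\infty)^4$ define $\mu_{\alpha,\mathbf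 t}$ on $K^4$ by $$d\mu_{\alpha,\mathbf t}(\mathbf a)=\rho_{t_1}(a_2^{-1}\alpha_1a_1)\,\rho_{t_2}(a_3^{-1}\alpha_2a_2)\,\rho_{t_3}(a_4^{-1}\alpha_3a_3)\,\rho_{t_4}(a_1^{-1}\alpha_4a_4)\,d\mathbf a,$$ where $d\mathbf a$ is the normalized Haar measure on $K^4$. Then for all $\alpha\in K^4$ and all $\mathbf t\in(0,\infty)^4$, the integrals below exist, the integral $\int_{K^4} f\,d\mu_{\alpha,\mathbf t}$ is differentiable in each $t_i$, and $$\left(\frac{\partial}{\partial t_1}-\frac{\partial}{\partial t_2}+\frac{\partial}{\partial t_3}-\frac{\partial}{\partial t_4}\right)\int_{K^4}f\,d\mu_{\alpha,\mathbf t}=-\int_{K^4}\nabla^{a_1}\cdot\nabla^{a_2}f\,d\mu_{\alpha,\mathbf t},$$ where, for any orthonormal basis $\{X\}$ of $\mathfrak k$, $$(\nabla^{a_1}\cdot\nabla^{a_2}f)(a_1,a_2,a_3,a_4)=\sum_X\left.\frac{\partial^2}{\partial s\,\partial t}f(a_1e^{sX},a_2e^{tX},a_3,a_4)\right|_{s=t=0}.$$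 -/

import Mathlib

open MeasureTheory Filter Topology
open scoped Manifold ContDiff

noncomputable section

namespace MakeenkoMigdal

variable {E : Type*} [NormedAddCommGroup E] [NormedSpace ℝ E]
  {H : Type*} [TopologicalSpace H] {I : ModelWithCorners ℝ E H}
  {K : Type*} [TopologicalSpace K] [ChartedSpace H K] [Group K]
  {F : Type*} [NormedAddCommGroup F] [NormedSpace ℝ F]

/-- The derivative of `u : K → F` along the left-invariant vector field associated with the
element `X` of the Lie algebra `T₁K`. For differentiable `u`, its value at `x` is
`d/ds u (x * exp (s X))` at `s = 0` (see `hasDerivAt_mul_curve`). -/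
def leftInvDeriv (X : GroupLieAlgebra I K) (u : K → F) (x : K) : F :=
  mfderiv I 𝓘(ℝ, F) u x (mulInvariantVectorField X x)

/-- A Riemannian metric on `K` is bi-invariant if all left translations and all right translations
are isometries. -/
structure IsBiInvariant [IsManifold I 1 K]
    (g : Bundle.ContMDiffRiemannianMetric I ∞ E (fun x : K => TangentSpace I x)) : Prop where
  left : ∀ (k x : K) (v w : TangentSpace I x),
    g.inner (k * x) (mfderiv I I (fun y => k * y) x v) (mfderiv I I (fun y => k * y) x w)
      = g.inner x v w
  right : ∀ (k x : K) (v w : TangentSpace I x),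
    g.inner (x * k) (mfderiv I I (fun y => y * k) x v) (mfderiv I I (fun y => y * k) x w)
      = g.inner x v w

/-- A basis `X` of the Lie algebra of `K` that is orthonormal for the value of the metric `g` at
the identity. -/
def IsOrthonormalFor [IsManifold I 1 K] {ι : Type*} [DecidableEq ι]
    (g : Bundle.ContMDiffRiemannianMetric I ∞ E (fun x : K => TangentSpace I x))
    (X : Module.Basis ι ℝ (GroupLieAlgebra I K)) : Prop :=
  ∀ i j : ι, g.inner (1 : K) (X i) (X j) = if i = j then 1 else 0

/-- The Laplacian on `K` as the sum of the squares of the left-invariant vector fields belonging to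
an orthonormal basis `X` of the Lie algebra. -/
def laplacian {ι : Type*} [Fintype ι] (X : Module.Basis ι ℝ (GroupLieAlgebra I K))
    (u : K → F) (x : K) : F :=
  ∑ i, leftInvDeriv (X i) (leftInvDeriv (X i) u) x

/-- `ρ` is the heat kernel (based at the identity): smooth for positive times, it solves
`∂ρ/∂t = (1/2) Δρ`, and `ρ t dx` converges weakly to the unit mass at the identity
as `t` decreases to `0`. -/
structure IsHeatKernel {ι : Type*} [Fintype ι] [MeasurableSpace K]
    (X : Module.Basis ι ℝ (GroupLieAlgebra I K)) (dx : Measure K) (ρ : ℝ → K → ℝ) : Prop where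
  smooth : ContMDiffOn (𝓘(ℝ, ℝ).prod I) 𝓘(ℝ, ℝ) ∞ (fun p : ℝ × K => ρ p.1 p.2)
    (Set.Ioi 0 ×ˢ Set.univ)
  heat_equation : ∀ t : ℝ, 0 < t → ∀ x : K,
    HasDerivAt (fun s => ρ s x) ((1 / 2 : ℝ) * laplacian X (ρ t) x) t
  initial : ∀ u : K → ℝ, Continuous u →
    Tendsto (fun t => ∫ x, u x * ρ t x ∂dx) (𝓝[>] 0) (𝓝 (u 1))

/-- Extended gauge invariance of a function on `K⁴`. -/
def ExtendedGaugeInvariant (f : K × K × K × K → ℂ) : Prop :=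
  ∀ a₁ a₂ a₃ a₄ x : K,
    f (a₁, a₂, a₃, a₄) = f (a₁ * x, a₂, a₃ * x, a₄) ∧
    f (a₁, a₂, a₃, a₄) = f (a₁, a₂ * x, a₃, a₄ * x)

/-- The product of the normalized Haar measures on `K⁴`. -/
def haar4 [MeasurableSpace K] (dx : Measure K) : Measure (K × K × K × K) :=
  dx.prod (dx.prod (dx.prod dx))

/-- The density of the measure `μ_{α,t}` on `K⁴` with respect to Haar measure (indices of `α` and
`t` start from `0`). -/
def density (ρ : ℝ → K → ℝ) (α : Fin 4 → K) (t : Fin 4 → ℝ) : K × K × K × K → ℝ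
  | (a₁, a₂, a₃, a₄) =>
    ρ (t 0) (a₂⁻¹ * α 0 * a₁) * ρ (t 1) (a₃⁻¹ * α 1 * a₂) *
      ρ (t 2) (a₄⁻¹ * α 2 * a₃) * ρ (t 3) (a₁⁻¹ * α 3 * a₄)

/-- The integral of `f` with respect to `dμ_{α,t} = density ρ α t · da`. -/
def muIntegral [MeasurableSpace K] (dx : Measure K) (ρ : ℝ → K → ℝ) (α : Fin 4 → K)
    (t : Fin 4 → ℝ) (f : K × K × K × K → ℂ) : ℂ :=
  ∫ a, density ρ α t a • f a ∂(haar4 dx)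

/-- `∇^{a₁} · ∇^{a₂} f`: the sum over the orthonormal basis `X` of the mixed second derivatives
`∂²/∂s∂t f (a₁ exp (s Xᵢ), a₂ exp (t Xᵢ), a₃, a₄)` at `s = t = 0`. -/
def gradDotGrad₁₂ {ι : Type*} [Fintype ι] (X : Module.Basis ι ℝ (GroupLieAlgebra I K))
    (f : K × K × K × K → ℂ) : K × K × K × K → ℂ
  | (a₁, a₂, a₃, a₄) =>
    ∑ i, leftInvDeriv (X i) (fun x => leftInvDeriv (X i) (fun y => f (x, y, a₃, a₄)) a₂) a₁

/-- `leftInvDeriv X u x` is the derivative at `s = 0` of `u (x * γ s)` for every curve `γ` through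
the identity with velocity `X`, in particular for the one-parameter subgroup `γ s = exp (s X)`. -/
theorem hasDerivAt_mul_curve [LieGroup I ∞ K] {X : GroupLieAlgebra I K} {u : K → F} {x : K}
    (hu : MDifferentiableAt I 𝓘(ℝ, F) u x) {γ : ℝ → K} (h0 : γ 0 = 1)
    (hγ : MDifferentiableAt 𝓘(ℝ, ℝ) I γ 0)
    (hX : (mfderiv 𝓘(ℝ, ℝ) I γ 0 (1 : ℝ) : E) = X) :
    HasDerivAt (fun s => u (x * γ s)) (leftInvDeriv X u x) 0 := by
  subst hX
  have hm : MDifferentiableAt I I (fun y => x * y) (1 : K) :=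
    (contMDiff_mul_left (I := I) (n := ∞) (a := x)).contMDiffAt.mdifferentiableAt (by simp)
  have h1 : HasMFDerivAt 𝓘(ℝ, ℝ) I γ 0 (mfderiv 𝓘(ℝ, ℝ) I γ 0) := hγ.hasMFDerivAt
  have h2 : HasMFDerivAt I I (fun y => x * y) (γ 0) (mfderiv I I (fun y => x * y) (γ 0)) := by
    rw [h0]; exact hm.hasMFDerivAt
  have h3 : HasMFDerivAt I 𝓘(ℝ, F) u (x * γ 0) (mfderiv I 𝓘(ℝ, F) u (x * γ 0)) := by
    rw [h0, mul_one]; exact hu.hasMFDerivAt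
  have h := h3.comp (0 : ℝ) (h2.comp (0 : ℝ) h1)
  have h' : HasFDerivAt (𝕜 := ℝ) (E := ℝ) (F := F) (fun s => u (x * γ s)) _ 0 :=
    hasMFDerivAt_iff_hasFDerivAt.1 h
  have h4 := h'.hasDerivAt
  convert h4 using 1
  simp only [leftInvDeriv, mulInvariantVectorField]
  rw [h0, mul_one]
  rfl

end MakeenkoMigdal

end

noncomputable section

namespace MakeenkoMigdal

/-! Fix one vector X of the orthonormal basis. Write ∂_j (j = 1, ..., 4) for the derivative under
right translation of a_j along X, A, B, C, D for the four heat kernel factors of the density, and a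
prime for the derivative of a heat kernel along X. The variable a_j enters factor j on the right
and, inverted, the cyclically preceding factor on the left. Since the heat kernel is a class
function, ∂_j puts a prime on factor j and minus a prime on the preceding one, while gauge
invariance gives ∂_3 f = -∂_1 f and ∂_4 f = -∂_2 f.

Integrate ∂_1∂_2 f by parts against ABCD. Moving ∂_1 hits A and D; in the term with D', replace ∂_2
f by -∂_4 f, and integrate by parts again. This leaves f times -A''BCD + ABCD'' + A'B'CD - ABC'D'
(`integral_mul₄_smul_flowDeriv_flowDeriv`). Gauge invariance also gives ∂_3∂_4 f = ∂_1∂_2 f, and the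
same computation with the roles rotated by two produces the opposite cross terms. In the sum only
alternating second derivatives survive (`two_mul_integral_flowDeriv_flowDeriv`). Summed over X they
are Laplacians, which the heat equation turns into time derivatives
(`IsHeatKernel.hasDerivAt_muIntegral`).

That ρ_t is a class function (`IsHeatKernel.conj_eq`) follows from uniqueness for the heat equation
(`heat_solution_eq_zero`): bi-invariance makes the adjoint action orthogonal, so the Laplacian
commutes with conjugation, and ρ_t and its conjugates solve the same initial value problem. -/

theorem integrable_of_continuous {F : Type*} [NormedAddCommGroup F] [SecondCountableTopology F]
    {N : Type*} [TopologicalSpace N] [CompactSpace N] [MeasurableSpace N] [OpensMeasurableSpace N]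
    {μ : Measure N} [IsFiniteMeasure μ] {v : N → F} (hv : Continuous v) : Integrable v μ :=
  hv.integrable_of_hasCompactSupport (HasCompactSupport.of_compactSpace _)

/-! ### Derivatives along families of self-maps, and integration by parts. -/

section Flow

variable {E' : Type*} [NormedAddCommGroup E'] [NormedSpace ℝ E']
  {H' : Type*} [TopologicalSpace H'] {J : ModelWithCorners ℝ E' H'}
  {M : Type*} [TopologicalSpace M] [ChartedSpace H' M]
  {F : Type*} [NormedAddCommGroup F] [NormedSpace ℝ F]

/-- The time derivative of a jointly smooth family of functions is jointly smooth. -/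
theorem contMDiffAt_deriv_param [IsManifold J ∞ M] {U : ℝ → M → F} {p₀ : ℝ × M}
    (hU : ContMDiffAt (𝓘(ℝ, ℝ).prod J) 𝓘(ℝ, F) ∞ (fun p : ℝ × M => U p.1 p.2) p₀) :
    ContMDiffAt (𝓘(ℝ, ℝ).prod J) 𝓘(ℝ, F) ∞
      (fun p : ℝ × M => deriv (fun r => U r p.2) p.1) p₀ := by
  have h := ContMDiffAt.mfderiv (I := 𝓘(ℝ, ℝ)) (I' := 𝓘(ℝ, F)) (J := 𝓘(ℝ, ℝ).prod J)
    (m := ∞) (n := ∞) (x₀ := p₀)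
    (f := fun (p : ℝ × M) (r : ℝ) => U r p.2) (g := Prod.fst)
    (by
      have hc : ContMDiffAt ((𝓘(ℝ, ℝ).prod J).prod 𝓘(ℝ, ℝ)) (𝓘(ℝ, ℝ).prod J) ∞
          (fun q : (ℝ × M) × ℝ => (q.2, q.1.2)) (p₀, p₀.1) :=
        contMDiffAt_snd.prodMk (contMDiffAt_snd.comp _ contMDiffAt_fst)
      exact ContMDiffAt.comp (p₀, p₀.1) (g := fun p : ℝ × M => U p.1 p.2) hU hc)
    contMDiffAt_fst (by simp)
  have h1 : ContMDiffAt (𝓘(ℝ, ℝ).prod J) 𝓘(ℝ, ℝ →L[ℝ] F) ∞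
      (fun p : ℝ × M => fderiv ℝ (fun r => U r p.2) p.1) p₀ := by
    -- Source and target of the differentiated map are vector spaces, so the tangent coordinate
    -- changes are trivial.
    refine h.congr_of_eventuallyEq (Eventually.of_forall fun p => ?_)
    simp only [← mfderiv_eq_fderiv]
    exact (congrFun (inTangentCoordinates_model_space (𝕜 := ℝ) (Prod.fst : ℝ × M → ℝ)
      (fun p : ℝ × M => U p.1 p.2)
      (fun p => mfderiv 𝓘(ℝ, ℝ) 𝓘(ℝ, F) (fun r => U r p.2) p.1) p₀) p).symm
  have h2 := ContMDiffAt.clm_apply h1 (contMDiffAt_const (c := (1 : ℝ)))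
  refine h2.congr_of_eventuallyEq (Eventually.of_forall fun p => ?_)
  exact (fderiv_apply_one_eq_deriv).symm

/-- Differentiation under the integral sign over a compact space. -/
theorem hasDerivAt_integral_of_compact {N : Type*} [TopologicalSpace N] [CompactSpace N]
    [MeasurableSpace N] [OpensMeasurableSpace N] [SecondCountableTopology F]
    (μ : Measure N) [IsFiniteMeasure μ] {U U' : ℝ → N → F} {S : Set ℝ} {s₀ : ℝ} (hS : S ∈ 𝓝 s₀)
    (hU : ∀ s ∈ S, Continuous (U s))
    (hd : ∀ s ∈ S, ∀ a, HasDerivAt (fun r => U r a) (U' s a) s)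
    (hU' : ContinuousOn (fun p : ℝ × N => U' p.1 p.2) (S ×ˢ Set.univ)) :
    HasDerivAt (fun s => ∫ a, U s a ∂μ) (∫ a, U' s₀ a ∂μ) s₀ := by
  -- A closed ball of times is compact, so its product with `N` is too and the derivative has a
  -- constant bound there.
  obtain ⟨ε, hε, hεS⟩ := Metric.nhds_basis_closedBall.mem_iff.1 hS
  have hcomp := (isCompact_closedBall s₀ ε).prod (isCompact_univ (X := N))
  obtain ⟨C, hC⟩ := hcomp.exists_bound_of_continuousOn
    (hU'.mono (Set.prod_mono hεS subset_rfl))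
  have hs₀ : s₀ ∈ S := mem_of_mem_nhds hS
  have hcont : Continuous (U' s₀) := by
    rw [← continuousOn_univ]
    exact hU'.comp (f := fun a : N => (s₀, a)) (by fun_prop) (fun a _ => ⟨hs₀, trivial⟩)
  refine (hasDerivAt_integral_of_dominated_loc_of_deriv_le (bound := fun _ => C)
    (Metric.closedBall_mem_nhds s₀ hε) ?_ ?_ ?_ ?_ (integrable_const C) ?_).2
  · filter_upwards [hS] with s hs using (hU s hs).aestronglyMeasurable
  · exact integrable_of_continuous (hU s₀ hs₀)
  · exact hcont.aestronglyMeasurable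
  · exact Eventually.of_forall fun a s hs => hC (s, a) ⟨hs, trivial⟩
  · exact Eventually.of_forall fun a s hs => hd s (hεS hs) a

variable (J) in
/-- A smooth one-parameter family of self-maps of a manifold starting at the identity. -/
structure IsSmoothFamily (T : ℝ → M → M) : Prop where
  smooth : ContMDiff (𝓘(ℝ, ℝ).prod J) J ∞ (fun p : ℝ × M => T p.1 p.2)
  zero : ∀ a, T 0 a = a

/-- The derivative of a function along a one-parameter family of self-maps at time `0`. -/
def flowDeriv (T : ℝ → M → M) (u : M → F) (a : M) : F := deriv (fun s => u (T s a)) 0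

variable {T T' : ℝ → M → M} {u : M → F}

theorem IsSmoothFamily.comp (hT : IsSmoothFamily J T) (hu : ContMDiff J 𝓘(ℝ, F) ∞ u) :
    ContMDiff (𝓘(ℝ, ℝ).prod J) 𝓘(ℝ, F) ∞ (fun p : ℝ × M => u (T p.1 p.2)) :=
  hu.comp hT.smooth

theorem IsSmoothFamily.contDiff (hT : IsSmoothFamily J T) (hu : ContMDiff J 𝓘(ℝ, F) ∞ u) (a : M) :
    ContDiff ℝ ∞ (fun s => u (T s a)) :=
  ((hT.comp hu).comp (contMDiff_id.prodMk contMDiff_const)).contDiff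

theorem IsSmoothFamily.hasDerivAt (hT : IsSmoothFamily J T) (hu : ContMDiff J 𝓘(ℝ, F) ∞ u) (a : M) :
    HasDerivAt (fun s => u (T s a)) (flowDeriv T u a) 0 :=
  ((hT.contDiff hu a).differentiable (by simp) 0).hasDerivAt

theorem IsSmoothFamily.contMDiff_flowDeriv [IsManifold J ∞ M] (hT : IsSmoothFamily J T)
    (hu : ContMDiff J 𝓘(ℝ, F) ∞ u) : ContMDiff J 𝓘(ℝ, F) ∞ (flowDeriv T u) := fun a =>
  ContMDiffAt.comp a (g := fun p : ℝ × M => deriv (fun r => u (T r p.2)) p.1)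
    (contMDiffAt_deriv_param (U := fun s a => u (T s a)) ((hT.comp hu) (0, a)))
    (contMDiffAt_const.prodMk contMDiffAt_id)

/-- Invariance of the measure makes `s ↦ ∫ u (T s a)` constant; differentiate it under the integral
at `s = 0`. -/
theorem IsSmoothFamily.integral_flowDeriv [IsManifold J ∞ M] [CompactSpace M] [MeasurableSpace M]
    [OpensMeasurableSpace M] [SecondCountableTopology F]
    (hT : IsSmoothFamily J T) {μ : Measure M} [IsFiniteMeasure μ]
    (hμ : ∀ (s : ℝ) (v : M → F), Continuous v → ∫ a, v (T s a) ∂μ = ∫ a, v a ∂μ)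
    (hu : ContMDiff J 𝓘(ℝ, F) ∞ u) : ∫ a, flowDeriv T u a ∂μ = 0 := by
  have h := hasDerivAt_integral_of_compact μ (U := fun s a => u (T s a))
    (U' := fun s a => deriv (fun r => u (T r a)) s) (S := Set.univ) (s₀ := 0) univ_mem
    (fun s _ => (hT.comp hu).continuous.comp (by fun_prop : Continuous fun a : M => (s, a)))
    (fun s _ a => ((hT.contDiff hu a).differentiable (by simp) s).hasDerivAt)
    (fun p _ => (contMDiffAt_deriv_param (U := fun s a => u (T s a))
      ((hT.comp hu) p)).continuousAt.continuousWithinAt)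
  have h2 : (fun s => ∫ a, u (T s a) ∂μ) = fun _ => ∫ a, u a ∂μ :=
    funext fun s => hμ s u hu.continuous
  rw [h2] at h
  exact h.unique (hasDerivAt_const _ _)

theorem IsSmoothFamily.flowDeriv_smul (hT : IsSmoothFamily J T) {v : M → ℝ}
    (hv : ContMDiff J 𝓘(ℝ, ℝ) ∞ v) (hu : ContMDiff J 𝓘(ℝ, F) ∞ u) (a : M) :
    flowDeriv T (fun a => v a • u a) a = v a • flowDeriv T u a + flowDeriv T v a • u a := by
  have h := (hT.hasDerivAt hv a).smul (hT.hasDerivAt hu a)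
  simp only [hT.zero] at h
  exact h.deriv

theorem IsSmoothFamily.integral_smul_flowDeriv [IsManifold J ∞ M] [CompactSpace M]
    [MeasurableSpace M] [OpensMeasurableSpace M] [SecondCountableTopology F]
    (hT : IsSmoothFamily J T) {μ : Measure M} [IsFiniteMeasure μ]
    (hμ : ∀ (s : ℝ) (v : M → F), Continuous v → ∫ a, v (T s a) ∂μ = ∫ a, v a ∂μ) {v : M → ℝ}
    (hv : ContMDiff J 𝓘(ℝ, ℝ) ∞ v) (hu : ContMDiff J 𝓘(ℝ, F) ∞ u) :
    ∫ a, v a • flowDeriv T u a ∂μ = - ∫ a, flowDeriv T v a • u a ∂μ := by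
  have h := hT.integral_flowDeriv hμ (u := fun a => v a • u a) (hv.smul hu)
  simp_rw [hT.flowDeriv_smul hv hu] at h
  have h2 := integral_add (μ := μ)
    (integrable_of_continuous (v := fun a => v a • flowDeriv T u a)
      (hv.continuous.smul (hT.contMDiff_flowDeriv hu).continuous))
    (integrable_of_continuous (v := fun a => flowDeriv T v a • u a)
      ((hT.contMDiff_flowDeriv hv).continuous.smul hu.continuous))
  exact eq_neg_of_add_eq_zero_left (h2.symm.trans h)

theorem deriv_deriv_comm {φ : ℝ × ℝ → F} (hφ : ContDiff ℝ ∞ φ) (x y : ℝ) :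
    deriv (fun s => deriv (fun r => φ (s, r)) y) x
      = deriv (fun r => deriv (fun s => φ (s, r)) x) y := by
  have h1 : ∀ s r, HasDerivAt (fun r => φ (s, r)) (fderiv ℝ φ (s, r) (0, 1)) r := fun s r =>
    (hφ.differentiable (by simp) (s, r)).hasFDerivAt.comp_hasDerivAt r
      ((hasDerivAt_const r s).prodMk (hasDerivAt_id r))
  have h2 : ∀ s r, HasDerivAt (fun s => φ (s, r)) (fderiv ℝ φ (s, r) (1, 0)) s := fun s r =>
    (hφ.differentiable (by simp) (s, r)).hasFDerivAt.comp_hasDerivAt s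
      ((hasDerivAt_id s).prodMk (hasDerivAt_const s r))
  have hd : Differentiable ℝ (fderiv ℝ φ) :=
    (hφ.fderiv_right (m := 1) (by norm_cast)).differentiable (by simp)
  have h3 : HasDerivAt (fun s => fderiv ℝ φ (s, y) (0, 1))
      (fderiv ℝ (fderiv ℝ φ) (x, y) (1, 0) (0, 1)) x := by
    have := (hd (x, y)).hasFDerivAt.comp_hasDerivAt x
      ((hasDerivAt_id x).prodMk (hasDerivAt_const x y))
    exact (ContinuousLinearMap.apply ℝ F ((0, 1) : ℝ × ℝ)).hasFDerivAt.comp_hasDerivAt x this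
  have h4 : HasDerivAt (fun r => fderiv ℝ φ (x, r) (1, 0))
      (fderiv ℝ (fderiv ℝ φ) (x, y) (0, 1) (1, 0)) y := by
    have := (hd (x, y)).hasFDerivAt.comp_hasDerivAt y
      ((hasDerivAt_const y x).prodMk (hasDerivAt_id y))
    exact (ContinuousLinearMap.apply ℝ F ((1, 0) : ℝ × ℝ)).hasFDerivAt.comp_hasDerivAt y this
  rw [show (fun s => deriv (fun r => φ (s, r)) y) = fun s => fderiv ℝ φ (s, y) (0, 1) from
      funext fun s => (h1 s y).deriv,
    show (fun r => deriv (fun s => φ (s, r)) x) = fun r => fderiv ℝ φ (x, r) (1, 0) from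
      funext fun r => (h2 x r).deriv, h3.deriv, h4.deriv]
  exact (hφ.contDiffAt.isSymmSndFDerivAt
    (by simpa using WithTop.coe_le_coe.2 (le_top (a := (2 : ℕ∞))))) _ _

/-- Commuting families make `u (T s (T' r a))` a smooth function on the plane whose mixed partials
are the two sides, so no bracket term arises. -/
theorem flowDeriv_comm (hT : IsSmoothFamily J T) (hT' : IsSmoothFamily J T')
    (hu : ContMDiff J 𝓘(ℝ, F) ∞ u) (hc : ∀ s r a, T s (T' r a) = T' r (T s a)) :
    flowDeriv T (flowDeriv T' u) = flowDeriv T' (flowDeriv T u) := by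
  funext a
  have h : ContDiff ℝ ∞ (fun p : ℝ × ℝ => u (T p.1 (T' p.2 a))) := by
    have h0 : ContMDiff 𝓘(ℝ, ℝ × ℝ) J ∞ (fun p : ℝ × ℝ => T' p.2 a) :=
      hT'.smooth.comp (contDiff_snd.contMDiff.prodMk contMDiff_const)
    have h1 : ContMDiff 𝓘(ℝ, ℝ × ℝ) J ∞ (fun p : ℝ × ℝ => T p.1 (T' p.2 a)) :=
      hT.smooth.comp (contDiff_fst.contMDiff.prodMk h0)
    exact (hu.comp h1).contDiff
  have := deriv_deriv_comm h 0 0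
  simpa only [flowDeriv, hc] using this

end Flow

/-! ### Left-invariant derivatives and the Laplacian on a Lie group. -/

section LieGroup

variable {E : Type*} [NormedAddCommGroup E] [NormedSpace ℝ E]
  {H : Type*} [TopologicalSpace H] {I : ModelWithCorners ℝ E H}
  {K : Type*} [TopologicalSpace K] [ChartedSpace H K] [Group K]
  {F : Type*} [NormedAddCommGroup F] [NormedSpace ℝ F]

/-- A smooth curve in `K` through the identity with velocity `X` at time `0`. -/
structure HasVelocity (γ : ℝ → K) (X : GroupLieAlgebra I K) : Prop where
  smooth : ContMDiff 𝓘(ℝ, ℝ) I ∞ γ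
  zero : γ 0 = 1
  velocity : (mfderiv 𝓘(ℝ, ℝ) I γ 0 (1 : ℝ) : E) = X

theorem leftInvDeriv_sum_vector {ι : Type*} (s : Finset ι) (c : ι → ℝ)
    (X : ι → GroupLieAlgebra I K) (u : K → F) (x : K) :
    leftInvDeriv (∑ i ∈ s, c i • X i) u x = ∑ i ∈ s, c i • leftInvDeriv (X i) u x := by
  let L : E →L[ℝ] F := (mfderiv I 𝓘(ℝ, F) u x : E →L[ℝ] F).comp
    (mfderiv I I (fun y => x * y) (1 : K) : E →L[ℝ] E)
  let X' : ι → E := X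
  change L (∑ i ∈ s, c i • X' i) = ∑ i ∈ s, c i • L (X' i)
  simp only [map_sum, map_smul]

variable [LieGroup I ∞ K]

/-- Only the velocity at time 0 matters for first derivatives, so a curve in one chart replaces the
exponential map. -/
theorem exists_hasVelocity [I.Boundaryless] (X : GroupLieAlgebra I K) :
    ∃ γ : ℝ → K, HasVelocity γ X := by
  have : IsManifold I ∞ K := inferInstance
  let v : E := X
  let φ := extChartAt I (1 : K)
  obtain ⟨ε, hε, hball⟩ := Metric.mem_nhds_iff.1 (extChartAt_target_mem_nhds (I := I) (1 : K))
  -- The function `δ sin (s / δ)` has slope 1 at 0 and is bounded by `δ`. With this `δ` the curve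
  -- stays in the chart for all times; the `+ 1` covers `v = 0`.
  let δ : ℝ := ε / (‖v‖ + 1)
  have hv : 0 < ‖v‖ + 1 := by positivity
  have hδ : 0 < δ := by positivity
  let c : ℝ → E := fun s => φ 1 + (δ * Real.sin (s / δ)) • v
  have hc : ∀ s, c s ∈ φ.target := fun s => hball <| by
    change dist (φ 1 + (δ * Real.sin (s / δ)) • v) (φ 1) < ε
    rw [dist_self_add_left, norm_smul, norm_mul, Real.norm_eq_abs, Real.norm_eq_abs, abs_of_pos hδ]
    calc δ * |Real.sin (s / δ)| * ‖v‖ ≤ δ * 1 * ‖v‖ := by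
          gcongr; exact Real.abs_sin_le_one _
      _ < δ * (‖v‖ + 1) := by nlinarith
      _ = ε := by simp only [δ]; field_simp
  have hcs : ContDiff ℝ ∞ c := by
    simp only [c]
    exact contDiff_const.add ((contDiff_const.mul (Real.contDiff_sin.comp
      (contDiff_id.div_const δ))).smul contDiff_const)
  have hγ : ContMDiff 𝓘(ℝ, ℝ) I ∞ (fun s => φ.symm (c s)) := by
    rw [← contMDiffOn_univ]
    exact (contMDiffOn_extChartAt_symm (1 : K)).comp hcs.contMDiff.contMDiffOn (fun s _ => hc s)
  have h0 : φ.symm (c 0) = 1 := by simp [c, φ]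
  have hcd : HasDerivAt c v 0 := by
    have h1 : HasDerivAt (fun s : ℝ => δ * Real.sin (s / δ)) (δ * (Real.cos (0 / δ) * (1 / δ))) 0 :=
      ((Real.hasDerivAt_sin _).comp 0 ((hasDerivAt_id (0 : ℝ)).div_const δ)).const_mul δ
    have h2 := (h1.smul_const v).const_add (φ 1)
    convert h2 using 1
    simp [mul_inv_cancel₀ hδ.ne']
  refine ⟨fun s => φ.symm (c s), hγ, h0, ?_⟩
  have hm : HasMFDerivAt 𝓘(ℝ, ℝ) I (fun s => φ.symm (c s)) 0
      (ContinuousLinearMap.toSpanSingleton ℝ v : ℝ →L[ℝ] E) := by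
    refine ⟨hγ.continuous.continuousAt, ?_⟩
    have hw : writtenInExtChartAt 𝓘(ℝ, ℝ) I (0 : ℝ) (fun s => φ.symm (c s)) = c := by
      funext s
      simp only [writtenInExtChartAt, h0, Function.comp]
      exact φ.right_inv (hc s)
    rw [hw]
    exact hcd.hasFDerivAt.hasFDerivWithinAt
  rw [hm.mfderiv]
  exact one_smul ℝ v

variable {γ : ℝ → K} {X : GroupLieAlgebra I K} {u : K → F}

theorem HasVelocity.contMDiff_mul (hγ : HasVelocity γ X) :
    ContMDiff (𝓘(ℝ, ℝ).prod I) I ∞ (fun p : ℝ × K => p.2 * γ p.1) :=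
  contMDiff_snd.mul (hγ.smooth.comp contMDiff_fst)

theorem HasVelocity.isSmoothFamily (hγ : HasVelocity γ X) :
    IsSmoothFamily I (fun (s : ℝ) (x : K) => x * γ s) :=
  ⟨hγ.contMDiff_mul, fun a => by simp [hγ.zero]⟩

theorem HasVelocity.hasDerivAt (hγ : HasVelocity γ X) {x : K}
    (hu : MDifferentiableAt I 𝓘(ℝ, F) u x) :
    HasDerivAt (fun s => u (x * γ s)) (leftInvDeriv X u x) 0 :=
  hasDerivAt_mul_curve hu hγ.zero (hγ.smooth.mdifferentiable (by simp) 0) hγ.velocity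

theorem HasVelocity.flowDeriv_eq (hγ : HasVelocity γ X) (hu : ContMDiff I 𝓘(ℝ, F) ∞ u) :
    flowDeriv (fun s x => x * γ s) u = leftInvDeriv X u :=
  funext fun x => (hγ.hasDerivAt (hu.mdifferentiable (by simp) x)).deriv

/-- The derivative along the inverse of a curve is minus the derivative along the curve. -/
theorem HasVelocity.hasDerivAt_inv (hγ : HasVelocity γ X) (hu : ContMDiff I 𝓘(ℝ, F) ∞ u) (x : K) :
    HasDerivAt (fun s => u (x * (γ s)⁻¹)) (-leftInvDeriv X u x) 0 := by
  -- `γ` need not be a homomorphism, so `(γ s)⁻¹` is not `γ (-s)`. Instead, `φ` is constant on the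
  -- diagonal, hence its two partial derivatives at the origin cancel.
  have hφ : ContDiff ℝ ∞ (fun p : ℝ × ℝ => u (x * (γ p.1 * (γ p.2)⁻¹))) := by
    have h1 : ContMDiff 𝓘(ℝ, ℝ × ℝ) I ∞ (fun p : ℝ × ℝ => x * (γ p.1 * (γ p.2)⁻¹)) :=
      contMDiff_const.mul ((hγ.smooth.comp contDiff_fst.contMDiff).mul
        (hγ.smooth.comp contDiff_snd.contMDiff).inv)
    exact (hu.comp h1).contDiff
  set φ : ℝ × ℝ → F := fun p => u (x * (γ p.1 * (γ p.2)⁻¹))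
  have hd := (hφ.differentiable (by simp) (0, 0)).hasFDerivAt
  have h1 : HasDerivAt (fun s : ℝ => φ (s, 0)) (fderiv ℝ φ (0, 0) (1, 0)) 0 :=
    hd.comp_hasDerivAt (f := fun s : ℝ => (s, (0 : ℝ))) 0
      ((hasDerivAt_id _).prodMk (hasDerivAt_const _ _))
  have h2 : HasDerivAt (fun s : ℝ => φ (0, s)) (fderiv ℝ φ (0, 0) (0, 1)) 0 :=
    hd.comp_hasDerivAt (f := fun s : ℝ => ((0 : ℝ), s)) 0
      ((hasDerivAt_const _ _).prodMk (hasDerivAt_id _))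
  have h3 : HasDerivAt (fun s : ℝ => φ (s, s)) (fderiv ℝ φ (0, 0) (1, 1)) 0 :=
    hd.comp_hasDerivAt (f := fun s : ℝ => (s, s)) 0 ((hasDerivAt_id _).prodMk (hasDerivAt_id _))
  have e1 := h1.unique (f := fun s : ℝ => φ (s, 0)) (by
    simpa [φ, hγ.zero] using hγ.hasDerivAt (hu.mdifferentiable (by simp) x))
  have e3 := h3.unique (f := fun s : ℝ => φ (s, s)) (by
    simpa [φ] using hasDerivAt_const (0 : ℝ) (u x))
  have e2 : fderiv ℝ φ (0, 0) (0, 1) = -leftInvDeriv X u x := by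
    rw [← e1, eq_neg_iff_add_eq_zero, ← map_add]
    simpa using e3
  rw [← e2]
  simpa [φ, hγ.zero] using h2

theorem leftInvDeriv_eq_mfderiv_one (hu : ContMDiff I 𝓘(ℝ, F) ∞ u) (x : K) :
    leftInvDeriv X u x = mfderiv I 𝓘(ℝ, F) (fun y => u (x * y)) 1 X := by
  have h := mfderiv_comp (1 : K) (g := u) (f := fun y => x * y)
    (hu.mdifferentiable (by simp) _)
    ((contMDiff_mul_left (I := I) (n := ∞) (a := x)).mdifferentiable (by simp) 1)
  have h' := congrArg (fun L : E →L[ℝ] F => L X) h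
  refine Eq.trans ?_ h'.symm
  simp only [leftInvDeriv, mulInvariantVectorField]
  change mfderiv I 𝓘(ℝ, F) u x _ = mfderiv I 𝓘(ℝ, F) u (x * 1) _
  rw [mul_one]
  rfl

/-- The adjoint action of `k` on the Lie algebra. -/
def adjoint (k : K) (X : GroupLieAlgebra I K) : GroupLieAlgebra I K :=
  (mfderiv I I (fun y : K => k * y * k⁻¹) 1 X : E)

theorem contMDiff_conj (k : K) : ContMDiff I I ∞ (fun y : K => k * y * k⁻¹) :=
  (contMDiff_const.mul contMDiff_id).mul contMDiff_const

/-- Conjugation by `k` is a homomorphism, so it carries left translation by `x` to left translation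
by `k * x * k⁻¹`; the chain rule at the identity does the rest. -/
theorem leftInvDeriv_conj (k : K) (hu : ContMDiff I 𝓘(ℝ, F) ∞ u) (x : K) :
    leftInvDeriv X (fun y => u (k * y * k⁻¹)) x = leftInvDeriv (adjoint k X) u (k * x * k⁻¹) := by
  rw [leftInvDeriv_eq_mfderiv_one (u := fun y => u (k * y * k⁻¹)) (hu.comp (contMDiff_conj k)),
    leftInvDeriv_eq_mfderiv_one hu]
  have hv : ContMDiff I 𝓘(ℝ, F) ∞ (fun z => u (k * x * k⁻¹ * z)) := hu.comp contMDiff_mul_left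
  have h := mfderiv_comp (1 : K) (g := fun z => u (k * x * k⁻¹ * z)) (f := fun y => k * y * k⁻¹)
    (hv.mdifferentiable (by simp) _) ((contMDiff_conj (I := I) k).mdifferentiable (by simp) 1)
  have h' := congrArg (fun L : E →L[ℝ] F => L X) h
  have e : (fun y => u (k * (x * y) * k⁻¹))
      = (fun z => u (k * x * k⁻¹ * z)) ∘ (fun y => k * y * k⁻¹) := by
    funext y; simp [mul_assoc]
  change mfderiv I 𝓘(ℝ, F) (fun y => u (k * (x * y) * k⁻¹)) 1 X = _
  rw [e]
  refine h'.trans ?_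
  change mfderiv I 𝓘(ℝ, F) (fun z => u (k * x * k⁻¹ * z)) (k * 1 * k⁻¹) _ = _
  rw [mul_one, mul_inv_cancel]
  rfl

variable [I.Boundaryless]

theorem contMDiff_leftInvDeriv (X : GroupLieAlgebra I K) (hu : ContMDiff I 𝓘(ℝ, F) ∞ u) :
    ContMDiff I 𝓘(ℝ, F) ∞ (leftInvDeriv X u) := by
  obtain ⟨γ, hγ⟩ := exists_hasVelocity X
  rw [← hγ.flowDeriv_eq hu]
  exact hγ.isSmoothFamily.contMDiff_flowDeriv hu

theorem leftInvDeriv_sum_smul {ι : Type*} (s : Finset ι) (c : ι → ℝ) (X : GroupLieAlgebra I K)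
    {u : ι → K → F} (hu : ∀ i, ContMDiff I 𝓘(ℝ, F) ∞ (u i)) (x : K) :
    leftInvDeriv X (fun y => ∑ i ∈ s, c i • u i y) x = ∑ i ∈ s, c i • leftInvDeriv X (u i) x := by
  obtain ⟨γ, hγ⟩ := exists_hasVelocity X
  have h := HasDerivAt.fun_sum (u := s) (x := (0 : ℝ)) (A := fun i r => c i • u i (x * γ r))
    (A' := fun i => c i • leftInvDeriv X (u i) x)
    (fun i _ => (hγ.hasDerivAt ((hu i).mdifferentiable (by simp) x)).const_smul (c i))
  have hs : ContMDiff I 𝓘(ℝ, F) ∞ (fun y => ∑ i ∈ s, c i • u i y) :=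
    contMDiff_finsetSum fun i _ =>
      (contMDiff_const (c := c i) (I := I) (I' := 𝓘(ℝ, ℝ))).smul (hu i)
  exact (hγ.hasDerivAt (hs.mdifferentiable (by simp) x)).unique h

theorem leftInvDeriv_sub (X : GroupLieAlgebra I K) {v : K → F} (hu : ContMDiff I 𝓘(ℝ, F) ∞ u)
    (hv : ContMDiff I 𝓘(ℝ, F) ∞ v) (x : K) :
    leftInvDeriv X (fun y => u y - v y) x = leftInvDeriv X u x - leftInvDeriv X v x := by
  obtain ⟨γ, hγ⟩ := exists_hasVelocity X
  exact (hγ.hasDerivAt ((hu.sub hv).mdifferentiable (by simp) x)).unique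
    ((hγ.hasDerivAt (hu.mdifferentiable (by simp) x)).sub
      (hγ.hasDerivAt (hv.mdifferentiable (by simp) x)))

variable {ι : Type*} [Fintype ι]

theorem contMDiff_laplacian (X : Module.Basis ι ℝ (GroupLieAlgebra I K))
    (hu : ContMDiff I 𝓘(ℝ, F) ∞ u) : ContMDiff I 𝓘(ℝ, F) ∞ (laplacian X u) :=
  contMDiff_finsetSum fun i _ => contMDiff_leftInvDeriv (X i) (contMDiff_leftInvDeriv (X i) hu)

theorem laplacian_sub (X : Module.Basis ι ℝ (GroupLieAlgebra I K)) {v : K → F}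
    (hu : ContMDiff I 𝓘(ℝ, F) ∞ u) (hv : ContMDiff I 𝓘(ℝ, F) ∞ v) (x : K) :
    laplacian X (fun y => u y - v y) x = laplacian X u x - laplacian X v x := by
  simp only [laplacian, ← Finset.sum_sub_distrib]
  refine Finset.sum_congr rfl fun i _ => ?_
  rw [← leftInvDeriv_sub (X i) (contMDiff_leftInvDeriv (X i) hu) (contMDiff_leftInvDeriv (X i) hv)]
  congr 1
  exact funext fun y => leftInvDeriv_sub (X i) hu hv y

end LieGroup

/-! ### Regularity of the heat kernel. -/

section HeatKernelRegularity

variable {E : Type*} [NormedAddCommGroup E] [NormedSpace ℝ E]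
  {H : Type*} [TopologicalSpace H] {I : ModelWithCorners ℝ E H}
  {K : Type*} [TopologicalSpace K] [ChartedSpace H K] [Group K] [MeasurableSpace K]
  {ι : Type*} [Fintype ι] {dx : Measure K}
  {X : Module.Basis ι ℝ (GroupLieAlgebra I K)} {ρ : ℝ → K → ℝ}

theorem IsHeatKernel.contMDiff (hρ : IsHeatKernel X dx ρ) {t : ℝ} (ht : 0 < t) :
    ContMDiff I 𝓘(ℝ, ℝ) ∞ (ρ t) := by
  rw [← contMDiffOn_univ]
  exact hρ.smooth.comp (f := fun x : K => (t, x))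
    (contMDiff_const.prodMk contMDiff_id).contMDiffOn (fun x _ => ⟨ht, trivial⟩)

/-- By the heat equation the Laplacian is twice the time derivative, whose joint continuity comes
from joint smoothness of the kernel. -/
theorem IsHeatKernel.continuousOn_laplacian [LieGroup I ∞ K] (hρ : IsHeatKernel X dx ρ) :
    ContinuousOn (fun p : ℝ × K => laplacian X (ρ p.1) p.2) (Set.Ioi 0 ×ˢ Set.univ) := by
  have : IsManifold I ∞ K := inferInstance
  intro p hp
  have ho : (Set.Ioi (0 : ℝ) ×ˢ (Set.univ : Set K)) ∈ 𝓝 p :=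
    (isOpen_Ioi.prod isOpen_univ).mem_nhds hp
  have h := (contMDiffAt_deriv_param (U := ρ) (hρ.smooth.contMDiffAt ho)).continuousAt.const_mul 2
  refine (h.congr ?_).continuousWithinAt
  filter_upwards [ho] with q hq
  rw [(hρ.heat_equation q.1 hq.1 q.2).deriv]
  ring

end HeatKernelRegularity

/-! ### Uniqueness for the heat equation and conjugation invariance of the heat kernel. -/

section HeatKernel

variable {E : Type*} [NormedAddCommGroup E] [NormedSpace ℝ E]
  {H : Type*} [TopologicalSpace H] {I : ModelWithCorners ℝ E H}
  {K : Type*} [TopologicalSpace K] [ChartedSpace H K] [Group K] [LieGroup I ∞ K]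
  {F : Type*} [NormedAddCommGroup F] [NormedSpace ℝ F] {u : K → F}

/-- Conjugation is a left translation followed by a right translation, both isometries. -/
theorem adjoint_inner {g : Bundle.ContMDiffRiemannianMetric I ∞ E (fun x : K => TangentSpace I x)}
    (hg : IsBiInvariant g) (k : K) (X Y : GroupLieAlgebra I K) :
    g.inner (1 : K) (adjoint k X) (adjoint k Y) = g.inner (1 : K) X Y := by
  have h := mfderiv_comp (1 : K) (g := fun y : K => y * k⁻¹) (f := fun y : K => k * y)
    ((contMDiff_mul_right (I := I) (n := ∞) (a := k⁻¹)).mdifferentiable (by simp) _)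
    ((contMDiff_mul_left (I := I) (n := ∞) (a := k)).mdifferentiable (by simp) 1)
  have h' : ∀ Z : GroupLieAlgebra I K, (adjoint k Z : E) =
      mfderiv I I (fun y : K => y * k⁻¹) (k * 1) (mfderiv I I (fun y : K => k * y) 1 Z) :=
    fun Z => congrArg (fun L : E →L[ℝ] E => L Z) h
  have hcast : ∀ y : K, y = 1 → ∀ v w : E,
      g.inner y (v : TangentSpace I y) (w : TangentSpace I y)
        = g.inner (1 : K) (v : TangentSpace I (1 : K)) (w : TangentSpace I (1 : K)) := by
    rintro y rfl v w; rfl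
  have h1 := hg.right k⁻¹ (k * 1) (mfderiv I I (fun y : K => k * y) 1 X)
    (mfderiv I I (fun y : K => k * y) 1 Y)
  rw [hg.left] at h1
  rw [← h1]
  refine Eq.trans ?_ (hcast (k * 1 * k⁻¹) (by simp) _ _).symm
  rw [← h' X, ← h' Y]

variable [I.Boundaryless] {ι : Type*} [Fintype ι]

/-- The Laplacian of a bi-invariant metric commutes with conjugations. -/
theorem laplacian_conj [DecidableEq ι]
    {g : Bundle.ContMDiffRiemannianMetric I ∞ E (fun x : K => TangentSpace I x)}
    (hg : IsBiInvariant g) {X : Module.Basis ι ℝ (GroupLieAlgebra I K)}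
    (hX : IsOrthonormalFor g X) (hu : ContMDiff I 𝓘(ℝ, F) ∞ u) (k x : K) :
    laplacian X (fun y => u (k * y * k⁻¹)) x = laplacian X u (k * x * k⁻¹) := by
  let O : Matrix ι ι ℝ := fun i j => X.repr (adjoint k (X i)) j
  have hO : ∀ i, adjoint k (X i) = ∑ j, O i j • X j := fun i => (X.sum_repr _).symm
  have hOO : O * O.transpose = 1 := by
    ext i l
    have h := adjoint_inner hg k (X i) (X l)
    rw [hX i l, hO i, hO l] at h
    simp only [map_sum, map_smul, _root_.sum_apply, _root_.smul_apply, hX _ _, smul_eq_mul,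
      mul_ite, mul_one, mul_zero, Finset.sum_ite_eq', Finset.mem_univ, if_true] at h
    rw [Matrix.mul_apply, Matrix.one_apply, ← h]
    exact Finset.sum_congr rfl fun j _ => mul_comm _ _
  have hOO' : ∀ j m, ∑ i, O i j * O i m = if j = m then 1 else 0 := fun j m => by
    -- Invariance of the metric gives orthonormal rows; the sum over `i` needs orthonormal columns.
    have h : O.transpose * O = 1 := mul_eq_one_comm.1 hOO
    have := congrArg (fun A : Matrix ι ι ℝ => A j m) h
    simpa only [Matrix.mul_apply, Matrix.one_apply, Matrix.transpose_apply] using this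
  have key : ∀ i, leftInvDeriv (X i) (leftInvDeriv (X i) (fun y => u (k * y * k⁻¹))) x
      = ∑ j, ∑ m, (O i j * O i m) • leftInvDeriv (X j) (leftInvDeriv (X m) u) (k * x * k⁻¹) := by
    intro i
    rw [show leftInvDeriv (X i) (fun y => u (k * y * k⁻¹))
        = fun y => leftInvDeriv (adjoint k (X i)) u (k * y * k⁻¹) from
      funext fun y => leftInvDeriv_conj k hu y,
      leftInvDeriv_conj k (contMDiff_leftInvDeriv _ hu), hO i, leftInvDeriv_sum_vector]
    refine Finset.sum_congr rfl fun j _ => ?_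
    rw [show leftInvDeriv (∑ j, O i j • X j) u = fun y => ∑ m, O i m • leftInvDeriv (X m) u y from
      funext fun y => leftInvDeriv_sum_vector _ _ _ _ _,
      leftInvDeriv_sum_smul _ _ _ fun m => contMDiff_leftInvDeriv (X m) hu, Finset.smul_sum]
    simp only [smul_smul]
  unfold laplacian
  rw [Finset.sum_congr rfl fun i _ => key i, Finset.sum_comm]
  refine Finset.sum_congr rfl fun j _ => ?_
  rw [Finset.sum_comm]
  simp only [← Finset.sum_smul, hOO', ite_smul, one_smul, zero_smul, Finset.sum_ite_eq,
    Finset.mem_univ, if_true]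

/-- The right translate of `μ` is again a Haar probability measure, and such a measure is unique. -/
theorem isMulRightInvariant_of_compactSpace {G : Type*} [TopologicalSpace G] [Group G]
    [IsTopologicalGroup G] [CompactSpace G] [MeasurableSpace G] [BorelSpace G]
    (μ : Measure G) [μ.IsHaarMeasure] [IsProbabilityMeasure μ] : μ.IsMulRightInvariant := by
  refine ⟨fun k => ?_⟩
  have : IsProbabilityMeasure (μ.map (· * k)) :=
    Measure.isProbabilityMeasure_map (by fun_prop)
  exact Measure.isHaarMeasure_eq_of_isProbabilityMeasure _ _

variable [IsTopologicalGroup K] [CompactSpace K] [MeasurableSpace K] [BorelSpace K]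
  {dx : Measure K} [dx.IsHaarMeasure] [IsProbabilityMeasure dx]

theorem integral_mul_leftInvDeriv (X : GroupLieAlgebra I K) {u v : K → ℝ}
    (hu : ContMDiff I 𝓘(ℝ, ℝ) ∞ u) (hv : ContMDiff I 𝓘(ℝ, ℝ) ∞ v) :
    ∫ x, v x * leftInvDeriv X u x ∂dx = -∫ x, leftInvDeriv X v x * u x ∂dx := by
  have := isMulRightInvariant_of_compactSpace dx
  have : IsManifold I ∞ K := inferInstance
  obtain ⟨γ, hγ⟩ := exists_hasVelocity X
  rw [← hγ.flowDeriv_eq hu, ← hγ.flowDeriv_eq hv]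
  exact hγ.isSmoothFamily.integral_smul_flowDeriv
    (fun s v _ => integral_mul_right_eq_self v (γ s)) hv hu

/-- The Laplacian is symmetric. -/
theorem integral_laplacian_mul (X : Module.Basis ι ℝ (GroupLieAlgebra I K)) {u v : K → ℝ}
    (hu : ContMDiff I 𝓘(ℝ, ℝ) ∞ u) (hv : ContMDiff I 𝓘(ℝ, ℝ) ∞ v) :
    ∫ x, laplacian X u x * v x ∂dx = ∫ x, u x * laplacian X v x ∂dx := by
  have hc := fun i => contMDiff_leftInvDeriv (X i) hu
  have hc' := fun i => contMDiff_leftInvDeriv (X i) hv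
  simp only [laplacian, Finset.sum_mul, Finset.mul_sum]
  have hu' := hu.continuous
  have hv' := hv.continuous
  have hcc := fun i => (contMDiff_leftInvDeriv (X i) (hc i)).continuous
  have hcc' := fun i => (contMDiff_leftInvDeriv (X i) (hc' i)).continuous
  rw [integral_finsetSum _ fun i _ => integrable_of_continuous (by fun_prop),
    integral_finsetSum _ fun i _ => integrable_of_continuous (by fun_prop)]
  refine Finset.sum_congr rfl fun i _ => ?_
  rw [integral_mul_leftInvDeriv _ (hc' i) hu, ← neg_eq_iff_eq_neg.2
    (integral_mul_leftInvDeriv (dx := dx) (X i) hv (hc i))]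

/-- Integration against a continuous function as a functional on continuous functions. -/
def integralFunctional (dx : Measure K) [IsProbabilityMeasure dx] (w : C(K, ℝ)) :
    C(K, ℝ) →L[ℝ] ℝ :=
  LinearMap.mkContinuous
    { toFun := fun u => ∫ x, u x * w x ∂dx
      map_add' := fun u v => by
        simp only [ContinuousMap.add_apply, add_mul]
        exact integral_add (integrable_of_continuous (u.continuous.mul w.continuous))
          (integrable_of_continuous (v.continuous.mul w.continuous))
      map_smul' := fun c u => by
        simp only [ContinuousMap.smul_apply, smul_eq_mul, mul_assoc, integral_const_mul,
          RingHom.id_apply] } ‖w‖ fun u => by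
    have h := norm_integral_le_of_norm_le_const (μ := dx) (f := fun x => u x * w x)
      (C := ‖w‖ * ‖u‖) (Eventually.of_forall fun x => by
        rw [norm_mul, mul_comm]
        exact mul_le_mul (w.norm_coe_le_norm x) (u.norm_coe_le_norm x) (norm_nonneg _)
          (norm_nonneg _))
    simpa using h

/-- A smooth solution of the heat equation for positive times which vanishes weakly at time `0`
is zero. -/
theorem heat_solution_eq_zero (X : Module.Basis ι ℝ (GroupLieAlgebra I K)) {w : ℝ → K → ℝ}
    (hw : ∀ t, 0 < t → ContMDiff I 𝓘(ℝ, ℝ) ∞ (w t))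
    (hd : ∀ t, 0 < t → ∀ x, HasDerivAt (fun s => w s x) ((1 / 2 : ℝ) * laplacian X (w t) x) t)
    (hc : ContinuousOn (fun p : ℝ × K => w p.1 p.2) (Set.Ioi 0 ×ˢ Set.univ))
    (hc' : ContinuousOn (fun p : ℝ × K => laplacian X (w p.1) p.2) (Set.Ioi 0 ×ˢ Set.univ))
    (h0 : ∀ u : K → ℝ, Continuous u → Tendsto (fun t => ∫ x, u x * w t x ∂dx) (𝓝[>] 0) (𝓝 0))
    {t : ℝ} (ht : 0 < t) (x : K) : w t x = 0 := by
  -- The initial condition is only weak, so the L² norm of `w s` is not controlled as `s → 0`. The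
  -- solution is therefore paired with its time reversal: `∫ w s * w (c - s)` is constant in `s` by
  -- symmetry of the Laplacian, equals `∫ (w t)²` at the midpoint `s = c / 2 = t`, and will be shown
  -- to tend to 0 as `s → 0`.
  obtain ⟨c, hcp, rfl⟩ : ∃ c : ℝ, 0 < c ∧ t = c / 2 := ⟨2 * t, by positivity, by ring⟩
  have hF : ∀ s ∈ Set.Ioo 0 c, HasDerivAt (fun s => ∫ x, w s x * w (c - s) x ∂dx) 0 s := by
    intro s hs
    have h := hasDerivAt_integral_of_compact dx (U := fun s x => w s x * w (c - s) x)
      (U' := fun s x => (1 / 2 : ℝ) * laplacian X (w s) x * w (c - s) x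
        + w s x * (-((1 / 2 : ℝ) * laplacian X (w (c - s)) x))) (isOpen_Ioo.mem_nhds hs)
      (fun s hs => (hw s hs.1).continuous.mul (hw _ (sub_pos.2 hs.2)).continuous)
      (fun s hs x => by
        have h2 : HasDerivAt (fun r => w (c - r) x)
            (-((1 / 2 : ℝ) * laplacian X (w (c - s)) x)) s := by
          exact HasDerivAt.comp_const_sub c s (hd (c - s) (sub_pos.2 hs.2) x)
        exact (hd s hs.1 x).mul h2)
      (by
        have m1 : Set.MapsTo (fun p : ℝ × K => p) (Set.Ioo 0 c ×ˢ Set.univ)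
            (Set.Ioi 0 ×ˢ Set.univ) := fun p hp => ⟨hp.1.1, trivial⟩
        have m2 : Set.MapsTo (fun p : ℝ × K => (c - p.1, p.2)) (Set.Ioo 0 c ×ˢ Set.univ)
            (Set.Ioi 0 ×ˢ Set.univ) := fun p hp => ⟨sub_pos.2 hp.1.2, trivial⟩
        have c2 : ContinuousOn (fun p : ℝ × K => (c - p.1, p.2)) (Set.Ioo 0 c ×ˢ Set.univ) := by
          fun_prop
        have a1 := hc.comp continuousOn_id m1
        have a2 := hc'.comp continuousOn_id m1
        have b1 := hc.comp c2 m2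
        have b2 := hc'.comp c2 m2
        exact ((continuousOn_const.mul a2).mul b1).add (a1.mul (continuousOn_const.mul b2).neg))
    have e := integral_laplacian_mul (dx := dx) X (hw s hs.1) (hw _ (sub_pos.2 hs.2))
    have hl := (contMDiff_laplacian X (hw s hs.1)).continuous
    have hl' := (contMDiff_laplacian X (hw _ (sub_pos.2 hs.2))).continuous
    have hs1 := (hw s hs.1).continuous
    have hs2 := (hw _ (sub_pos.2 hs.2)).continuous
    have : ∀ x, (1 / 2 : ℝ) * laplacian X (w s) x * w (c - s) x
        + w s x * (-((1 / 2 : ℝ) * laplacian X (w (c - s)) x))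
        = (1 / 2 : ℝ) * (laplacian X (w s) x * w (c - s) x - w s x * laplacian X (w (c - s)) x) :=
      fun x => by ring
    refine h.congr_deriv ((integral_congr_ae (Eventually.of_forall this)).trans ?_)
    rw [integral_const_mul, integral_sub (integrable_of_continuous (by fun_prop))
      (integrable_of_continuous (by fun_prop)), e, sub_self, mul_zero]
  have hhalf : c / 2 ∈ Set.Ioo 0 c := ⟨by positivity, by linarith⟩
  have hconst : ∀ s ∈ Set.Ioo 0 c,
      ∫ x, w s x * w (c - s) x ∂dx = ∫ x, w (c / 2) x * w (c / 2) x ∂dx := by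
    intro s hs
    have := isOpen_Ioo.is_const_of_deriv_eq_zero isPreconnected_Ioo
      (fun s hs => (hF s hs).differentiableAt.differentiableWithinAt)
      (fun s hs => (hF s hs).deriv) hs hhalf
    simpa only [sub_half] using this
  -- Currying turns joint continuity into continuity of `s ↦ w s` in the uniform norm, `K` being
  -- compact.
  let W : C(Set.Ioi (0 : ℝ), C(K, ℝ)) := ContinuousMap.curry
    ⟨fun p : Set.Ioi (0 : ℝ) × K => w p.1 p.2, by
      rw [← continuousOn_univ]
      exact hc.comp (f := fun p : Set.Ioi (0 : ℝ) × K => ((p.1 : ℝ), p.2)) (by fun_prop)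
        (fun p _ => ⟨p.1.2, trivial⟩)⟩
  -- The shift by 2 keeps `σ n` strictly below `c` already at `n = 0`.
  let σ : ℕ → ℝ := fun n => c / (n + 2)
  have hσ : ∀ n, σ n ∈ Set.Ioo 0 c := fun n =>
    ⟨by positivity, div_lt_self hcp (by linarith [n.cast_nonneg (α := ℝ)])⟩
  have hσ0 : Tendsto σ atTop (𝓝 0) := by
    refine tendsto_const_nhds.div_atTop ?_
    exact tendsto_atTop_add_const_right _ _ tendsto_natCast_atTop_atTop
  have hσ' : Tendsto σ atTop (𝓝[>] 0) :=
    tendsto_nhdsWithin_iff.2 ⟨hσ0, Eventually.of_forall fun n => (hσ n).1⟩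
  let G : ℕ → C(K, ℝ) →L[ℝ] ℝ := fun n => integralFunctional dx (W ⟨σ n, (hσ n).1⟩)
  have hG : ∀ u : C(K, ℝ), Tendsto (fun n => G n u) atTop (𝓝 0) := fun u =>
    (h0 u u.continuous).comp hσ'
  -- Weak convergence bounds each functional sequence pointwise, hence the functionals `G n`
  -- uniformly. This allows `G n` to be applied to the moving functions `V n`, which converge
  -- uniformly.
  obtain ⟨C, hC⟩ := banach_steinhaus (g := G) fun u => by
    obtain ⟨C, hC⟩ := (hG u).norm.bddAbove_range
    exact ⟨C, fun n => hC ⟨n, rfl⟩⟩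
  let V : ℕ → C(K, ℝ) := fun n => W ⟨c - σ n, sub_pos.2 (hσ n).2⟩
  have hV : Tendsto V atTop (𝓝 (W ⟨c, hcp⟩)) := by
    refine (W.continuous.tendsto _).comp (tendsto_subtype_rng.2 ?_)
    simpa using tendsto_const_nhds.sub hσ0
  have hGV : Tendsto (fun n => G n (V n)) atTop (𝓝 0) := by
    have h1 : Tendsto (fun n => G n (V n - W ⟨c, hcp⟩)) atTop (𝓝 0) := by
      refine squeeze_zero_norm (a := fun n => C * ‖V n - W ⟨c, hcp⟩‖)
        (fun n => (G n).le_of_opNorm_le (hC n) _) ?_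
      simpa using (tendsto_iff_norm_sub_tendsto_zero.1 hV).const_mul C
    simpa using h1.add (hG (W ⟨c, hcp⟩))
  have hGV' : ∀ n, G n (V n) = ∫ x, w (c / 2) x * w (c / 2) x ∂dx := fun n => by
    rw [← hconst (σ n) (hσ n)]
    exact integral_congr_ae (Eventually.of_forall fun x => mul_comm _ _)
  simp_rw [hGV'] at hGV
  have hz := tendsto_nhds_unique tendsto_const_nhds hGV
  have hcw := (hw (c / 2) ht).continuous
  have hz' := (integral_eq_zero_iff_of_nonneg (fun x => mul_self_nonneg _)
    (integrable_of_continuous (hcw.mul hcw))).1 hz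
  have := congrFun ((hcw.mul hcw).ae_eq_iff_eq dx continuous_const |>.1 hz') x
  exact mul_self_eq_zero.1 this

variable {X : Module.Basis ι ℝ (GroupLieAlgebra I K)} {ρ : ℝ → K → ℝ}

/-- The heat kernel of a bi-invariant metric is invariant under conjugation. -/
theorem IsHeatKernel.conj_eq [DecidableEq ι]
    {g : Bundle.ContMDiffRiemannianMetric I ∞ E (fun x : K => TangentSpace I x)}
    (hg : IsBiInvariant g) (hX : IsOrthonormalFor g X) (hρ : IsHeatKernel X dx ρ)
    {t : ℝ} (ht : 0 < t) (k x : K) : ρ t (k * x * k⁻¹) = ρ t x := by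
  have hsm : ∀ t, 0 < t → ContMDiff I 𝓘(ℝ, ℝ) ∞ (fun x => ρ t (k * x * k⁻¹)) :=
    fun t ht => (hρ.contMDiff ht).comp (contMDiff_conj k)
  have hlap : ∀ t, 0 < t → ∀ x, laplacian X (fun y => ρ t y - ρ t (k * y * k⁻¹)) x
      = laplacian X (ρ t) x - laplacian X (ρ t) (k * x * k⁻¹) := fun t ht x => by
    rw [laplacian_sub X (hρ.contMDiff ht) (hsm t ht), laplacian_conj hg hX (hρ.contMDiff ht)]
  have hcc : ContinuousOn (fun p : ℝ × K => (p.1, k * p.2 * k⁻¹)) (Set.Ioi 0 ×ˢ Set.univ) := by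
    fun_prop
  have hm : Set.MapsTo (fun p : ℝ × K => (p.1, k * p.2 * k⁻¹)) (Set.Ioi 0 ×ˢ Set.univ)
      (Set.Ioi 0 ×ˢ Set.univ) := fun p hp => ⟨hp.1, trivial⟩
  have := isMulRightInvariant_of_compactSpace dx
  have h := heat_solution_eq_zero (dx := dx) X (w := fun t x => ρ t x - ρ t (k * x * k⁻¹))
    (fun t ht => (hρ.contMDiff ht).sub (hsm t ht))
    (fun t ht x => by
      rw [hlap t ht x, mul_sub]
      exact (hρ.heat_equation t ht x).sub (hρ.heat_equation t ht _))
    (hρ.smooth.continuousOn.sub (hρ.smooth.continuousOn.comp hcc hm))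
    ((hρ.continuousOn_laplacian.sub (hρ.continuousOn_laplacian.comp hcc hm)).congr
      fun p hp => hlap p.1 hp.1 p.2)
    (fun u hu => by
      have h1 := hρ.initial u hu
      -- Conjugation fixes the identity, so `u` and its conjugate have the same limit; invariance of
      -- Haar measure moves the conjugation onto the kernel.
      have h2 := hρ.initial (fun x => u (k⁻¹ * x * k)) (by fun_prop)
      simp only [mul_one, inv_mul_cancel] at h2
      have h3 := h1.sub h2
      rw [sub_self] at h3
      refine h3.congr' ?_
      filter_upwards [self_mem_nhdsWithin] with t ht
      have e : ∫ x, u (k⁻¹ * x * k) * ρ t x ∂dx = ∫ x, u x * ρ t (k * x * k⁻¹) ∂dx := by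
        rw [← integral_mul_right_eq_self _ k⁻¹, ← integral_mul_left_eq_self _ k]
        simp [mul_assoc]
      have hc := (hρ.contMDiff ht).continuous
      have hc2 := (hsm t ht).continuous
      simp only [mul_sub]
      rw [e, integral_sub (integrable_of_continuous (by fun_prop))
        (integrable_of_continuous (by fun_prop))]) ht x
  exact (sub_eq_zero.1 h).symm

end HeatKernel

theorem flowDeriv_neg {M F : Type*} [NormedAddCommGroup F] [NormedSpace ℝ F] (T : ℝ → M → M)
    (u : M → F) : flowDeriv T (fun a => -u a) = fun a => -flowDeriv T u a :=
  funext fun _ => deriv.fun_neg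

/-! ### Double integration by parts against a product of four densities. -/

section FourFlows

variable {E' : Type*} [NormedAddCommGroup E'] [NormedSpace ℝ E']
  {H' : Type*} [TopologicalSpace H'] {J : ModelWithCorners ℝ E' H'}
  {M : Type*} [TopologicalSpace M] [ChartedSpace H' M]
  {F : Type*} [NormedAddCommGroup F] [NormedSpace ℝ F]

theorem IsSmoothFamily.flowDeriv_mul₄ {T : ℝ → M → M} (hT : IsSmoothFamily J T)
    {A B C D : M → ℝ} (hA : ContMDiff J 𝓘(ℝ, ℝ) ∞ A) (hB : ContMDiff J 𝓘(ℝ, ℝ) ∞ B)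
    (hC : ContMDiff J 𝓘(ℝ, ℝ) ∞ C) (hD : ContMDiff J 𝓘(ℝ, ℝ) ∞ D) (a : M) :
    flowDeriv T (fun a => A a * B a * C a * D a) a
      = flowDeriv T A a * B a * C a * D a + A a * flowDeriv T B a * C a * D a
        + A a * B a * flowDeriv T C a * D a + A a * B a * C a * flowDeriv T D a := by
  have h := (((hT.hasDerivAt hA a).fun_mul (hT.hasDerivAt hB a)).fun_mul
    (hT.hasDerivAt hC a)).fun_mul (hT.hasDerivAt hD a)
  simp only [hT.zero] at h
  refine h.deriv.trans ?_
  ring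

variable [IsManifold J ∞ M] [CompactSpace M] [MeasurableSpace M] [OpensMeasurableSpace M]
  [SecondCountableTopology F] {μ : Measure M} [IsFiniteMeasure μ]

/-- Integration by parts of a mixed second derivative against a product of four densities, when the
derivatives of consecutive densities are related cyclically. -/
theorem integral_mul₄_smul_flowDeriv_flowDeriv {T₁ T₂ T₄ : ℝ → M → M} (h₁ : IsSmoothFamily J T₁)
    (h₂ : IsSmoothFamily J T₂) (h₄ : IsSmoothFamily J T₄)
    (hμ₁ : ∀ (s : ℝ) (v : M → F), Continuous v → ∫ a, v (T₁ s a) ∂μ = ∫ a, v a ∂μ)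
    (hμ₂ : ∀ (s : ℝ) (v : M → F), Continuous v → ∫ a, v (T₂ s a) ∂μ = ∫ a, v a ∂μ)
    (hμ₄ : ∀ (s : ℝ) (v : M → F), Continuous v → ∫ a, v (T₄ s a) ∂μ = ∫ a, v a ∂μ)
    (hcomm : ∀ s r a, T₁ s (T₂ r a) = T₂ r (T₁ s a)) {f : M → F} (hf : ContMDiff J 𝓘(ℝ, F) ∞ f)
    (hf₂ : ∀ a, flowDeriv T₂ f a = -flowDeriv T₄ f a) {A B C D A' B' C' D' : M → ℝ}
    (hA : ContMDiff J 𝓘(ℝ, ℝ) ∞ A) (hB : ContMDiff J 𝓘(ℝ, ℝ) ∞ B)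
    (hC : ContMDiff J 𝓘(ℝ, ℝ) ∞ C) (hD : ContMDiff J 𝓘(ℝ, ℝ) ∞ D)
    (h1A : flowDeriv T₁ A = A') (h1B : ∀ a, flowDeriv T₁ B a = 0)
    (h1C : ∀ a, flowDeriv T₁ C a = 0) (h1D : ∀ a, flowDeriv T₁ D a = -D' a)
    (h2A : ∀ a, flowDeriv T₂ A a = -A' a) (h2B : ∀ a, flowDeriv T₂ B a = B' a)
    (h2C : ∀ a, flowDeriv T₂ C a = 0) (h2D : ∀ a, flowDeriv T₂ D a = 0)
    (h4A : ∀ a, flowDeriv T₄ A a = 0) (h4B : ∀ a, flowDeriv T₄ B a = 0)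
    (h4C : ∀ a, flowDeriv T₄ C a = -C' a) (h4D : flowDeriv T₄ D = D') :
    ∫ a, (A a * B a * C a * D a) • flowDeriv T₁ (flowDeriv T₂ f) a ∂μ
      = ∫ a, (-(flowDeriv T₁ A' a) * B a * C a * D a + A' a * B' a * C a * D a
          + A a * B a * C a * flowDeriv T₄ D' a - A a * B a * C' a * D' a) • f a ∂μ := by
  have hA' : ContMDiff J 𝓘(ℝ, ℝ) ∞ A' := h1A ▸ h₁.contMDiff_flowDeriv hA
  have hD' : ContMDiff J 𝓘(ℝ, ℝ) ∞ D' := h4D ▸ h₄.contMDiff_flowDeriv hD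
  have hf2 := h₂.contMDiff_flowDeriv hf
  -- A derivative `A'` along a single direction need not come from a class function, so its
  -- `T₂`-derivative is obtained by commuting the two flows.
  have h2A' : ∀ a, flowDeriv T₂ A' a = -flowDeriv T₁ A' a := fun a => by
    rw [← h1A, ← flowDeriv_comm h₁ h₂ hA hcomm, h1A, funext h2A, flowDeriv_neg]
  have hP : ContMDiff J 𝓘(ℝ, ℝ) ∞ (fun a => A' a * B a * C a * D a) :=
    ((hA'.mul hB).mul hC).mul hD
  have hQ : ContMDiff J 𝓘(ℝ, ℝ) ∞ (fun a => A a * B a * C a * D' a) :=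
    ((hA.mul hB).mul hC).mul hD'
  have hPc := (h₂.contMDiff_flowDeriv hP).continuous
  have hQc := (h₄.contMDiff_flowDeriv hQ).continuous
  have hPc0 := hP.continuous
  have hQc0 := hQ.continuous
  have hfc := hf.continuous
  have hf2c := hf2.continuous
  rw [h₁.integral_smul_flowDeriv hμ₁ (v := fun a => A a * B a * C a * D a)
    (((hA.mul hB).mul hC).mul hD) hf2]
  -- In the term where `D` was differentiated, `T₂` is traded for `T₄` through `hf₂`; the next
  -- integration by parts then meets `C` and `D'` instead of `A` and `B`.
  have e1 : ∀ a, flowDeriv T₁ (fun a => A a * B a * C a * D a) a • flowDeriv T₂ f a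
      = (A' a * B a * C a * D a) • flowDeriv T₂ f a
        + (A a * B a * C a * D' a) • flowDeriv T₄ f a := fun a => by
    rw [h₁.flowDeriv_mul₄ hA hB hC hD, h1A, h1B, h1C, h1D, ← neg_neg (flowDeriv T₄ f a), ← hf₂]
    module
  simp_rw [e1]
  rw [integral_add (integrable_of_continuous (hPc0.fun_smul hf2c))
    (integrable_of_continuous (hQc0.fun_smul (h₄.contMDiff_flowDeriv hf).continuous)),
    h₂.integral_smul_flowDeriv hμ₂ hP hf, h₄.integral_smul_flowDeriv hμ₄ hQ hf, neg_add, neg_neg,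
    neg_neg, ← integral_add (integrable_of_continuous (hPc.fun_smul hfc))
      (integrable_of_continuous (hQc.fun_smul hfc))]
  refine integral_congr_ae (Eventually.of_forall fun a => ?_)
  beta_reduce
  rw [h₂.flowDeriv_mul₄ hA' hB hC hD, h₄.flowDeriv_mul₄ hA hB hC hD', h2A', h2B, h2C, h2D, h4A,
    h4B, h4C]
  module

end FourFlows

/-! ### Combinatorics of the four variables and the four holonomies. -/

section Slots

variable {K : Type*} [Group K]

/-- The embedding of `K` as the `j`-th factor of `K⁴`. -/
def slot (j : Fin 4) (k : K) : K × K × K × K :=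
  match j with
  | 0 => (k, 1, 1, 1)
  | 1 => (1, k, 1, 1)
  | 2 => (1, 1, k, 1)
  | 3 => (1, 1, 1, k)

/-- The argument of the `i`-th heat kernel in the density. -/
def holonomy (α : Fin 4 → K) (i : Fin 4) (a : K × K × K × K) : K :=
  match i with
  | 0 => a.2.1⁻¹ * α 0 * a.1
  | 1 => a.2.2.1⁻¹ * α 1 * a.2.1
  | 2 => a.2.2.2⁻¹ * α 2 * a.2.2.1
  | 3 => a.1⁻¹ * α 3 * a.2.2.2

/-- Addition in `Fin 4` is cyclic, so `i + 1` also covers the last holonomy, which contains the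
inverse of the first variable. -/
theorem holonomy_mul_slot (α : Fin 4 → K) (i j : Fin 4) (a : K × K × K × K) (k : K) :
    holonomy α i (a * slot j k) = if j = i then holonomy α i a * k
      else if j = i + 1 then k⁻¹ * holonomy α i a else holonomy α i a := by
  fin_cases i <;> fin_cases j <;> simp [holonomy, slot, mul_assoc]

theorem density_eq_prod (ρ : ℝ → K → ℝ) (α : Fin 4 → K) (t : Fin 4 → ℝ) (a : K × K × K × K) :
    density ρ α t a = ∏ i, ρ (t i) (holonomy α i a) := by
  simp [Fin.prod_univ_four, density, holonomy]

theorem slot_comm {i j : Fin 4} (hij : i ≠ j) (k l : K) :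
    slot i k * slot j l = slot j l * slot i k := by
  fin_cases i <;> fin_cases j <;> simp_all [slot]

/-- Right translation of the `j`-th variable along a curve. -/
def slotFlow (γ : ℝ → K) (j : Fin 4) (s : ℝ) (a : K × K × K × K) : K × K × K × K :=
  a * slot j (γ s)

theorem slotFlow_comm (γ : ℝ → K) {i j : Fin 4} (hij : i ≠ j) (s r : ℝ) (a : K × K × K × K) :
    slotFlow γ i s (slotFlow γ j r a) = slotFlow γ j r (slotFlow γ i s a) := by
  simp only [slotFlow, mul_assoc, slot_comm hij]

theorem flowDeriv_holonomy_of_ne {γ : ℝ → K} {α : Fin 4 → K} {u : K → ℝ} {i j : Fin 4}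
    (hij : j ≠ i) (hij' : j ≠ i + 1)
    (a : K × K × K × K) : flowDeriv (slotFlow γ j) (fun a => u (holonomy α i a)) a = 0 := by
  simp only [flowDeriv, slotFlow, holonomy_mul_slot, if_neg hij, if_neg hij', deriv_const]

end Slots

/-! ### Derivatives of the gauge-invariant function and of the density factors. -/

section FourFold

variable {E : Type*} [NormedAddCommGroup E] [NormedSpace ℝ E]
  {H : Type*} [TopologicalSpace H] {I : ModelWithCorners ℝ E H}
  {K : Type*} [TopologicalSpace K] [ChartedSpace H K] [Group K]
  {F : Type*} [NormedAddCommGroup F] [NormedSpace ℝ F]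

theorem contMDiff_slot (j : Fin 4) :
    ContMDiff I (I.prod (I.prod (I.prod I))) ∞ (slot j : K → K × K × K × K) := by
  have hid : ContMDiff I I ∞ (fun k : K => k) := contMDiff_id
  have h1 : ContMDiff I I ∞ (fun _ : K => (1 : K)) := contMDiff_const
  fin_cases j
  · exact hid.prodMk (h1.prodMk (h1.prodMk h1))
  · exact h1.prodMk (hid.prodMk (h1.prodMk h1))
  · exact h1.prodMk (h1.prodMk (hid.prodMk h1))
  · exact h1.prodMk (h1.prodMk (h1.prodMk hid))

variable [LieGroup I ∞ K]

theorem contMDiff_holonomy (α : Fin 4 → K) (i : Fin 4) :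
    ContMDiff (I.prod (I.prod (I.prod I))) I ∞ (holonomy α i) := by
  have p1 : ContMDiff (I.prod (I.prod (I.prod I))) I ∞ (fun a : K × K × K × K => a.1) :=
    contMDiff_fst
  have p2 : ContMDiff (I.prod (I.prod (I.prod I))) I ∞ (fun a : K × K × K × K => a.2.1) :=
    contMDiff_fst.comp contMDiff_snd
  have p3 : ContMDiff (I.prod (I.prod (I.prod I))) I ∞ (fun a : K × K × K × K => a.2.2.1) :=
    contMDiff_fst.comp (contMDiff_snd.comp contMDiff_snd)
  have p4 : ContMDiff (I.prod (I.prod (I.prod I))) I ∞ (fun a : K × K × K × K => a.2.2.2) :=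
    contMDiff_snd.comp (contMDiff_snd.comp contMDiff_snd)
  fin_cases i
  · exact (p2.inv.mul contMDiff_const).mul p1
  · exact (p3.inv.mul contMDiff_const).mul p2
  · exact (p4.inv.mul contMDiff_const).mul p3
  · exact (p1.inv.mul contMDiff_const).mul p4

variable {γ : ℝ → K} {X : GroupLieAlgebra I K}

theorem HasVelocity.isSmoothFamily_slotFlow (hγ : HasVelocity γ X) (j : Fin 4) :
    IsSmoothFamily (I.prod (I.prod (I.prod I))) (slotFlow γ j) where
  smooth := contMDiff_snd.mul ((contMDiff_slot j).comp (hγ.smooth.comp contMDiff_fst))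
  zero a := by
    have : slot j (1 : K) = 1 := by fin_cases j <;> rfl
    simp [slotFlow, hγ.zero, this]

theorem HasVelocity.flowDeriv_slotFlow_zero (hγ : HasVelocity γ X) {f : K × K × K × K → F}
    (hf : ContMDiff (I.prod (I.prod (I.prod I))) 𝓘(ℝ, F) ∞ f) (a₁ a₂ a₃ a₄ : K) :
    flowDeriv (slotFlow γ 0) f (a₁, a₂, a₃, a₄)
      = leftInvDeriv X (fun x => f (x, a₂, a₃, a₄)) a₁ := by
  have hu : ContMDiff I 𝓘(ℝ, F) ∞ (fun x => f (x, a₂, a₃, a₄)) :=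
    hf.comp (contMDiff_id.prodMk contMDiff_const)
  rw [← hγ.flowDeriv_eq hu]
  simp [flowDeriv, slotFlow, slot]

theorem HasVelocity.flowDeriv_slotFlow_one (hγ : HasVelocity γ X) {f : K × K × K × K → F}
    (hf : ContMDiff (I.prod (I.prod (I.prod I))) 𝓘(ℝ, F) ∞ f) (a₁ a₂ a₃ a₄ : K) :
    flowDeriv (slotFlow γ 1) f (a₁, a₂, a₃, a₄)
      = leftInvDeriv X (fun x => f (a₁, x, a₃, a₄)) a₂ := by
  have hu : ContMDiff I 𝓘(ℝ, F) ∞ (fun x => f (a₁, x, a₃, a₄)) :=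
    hf.comp (contMDiff_const.prodMk (contMDiff_id.prodMk contMDiff_const))
  rw [← hγ.flowDeriv_eq hu]
  simp [flowDeriv, slotFlow, slot]

/-- Gauge invariance moves a right factor `γ s` from the third variable to a right factor `(γ s)⁻¹`
on the first. -/
theorem HasVelocity.flowDeriv_slotFlow_two (hγ : HasVelocity γ X) {f : K × K × K × K → ℂ}
    (hf : ContMDiff (I.prod (I.prod (I.prod I))) 𝓘(ℝ, ℂ) ∞ f) (hinv : ExtendedGaugeInvariant f)
    (a : K × K × K × K) : flowDeriv (slotFlow γ 2) f a = -flowDeriv (slotFlow γ 0) f a := by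
  obtain ⟨a₁, a₂, a₃, a₄⟩ := a
  have hu : ContMDiff I 𝓘(ℝ, ℂ) ∞ (fun x => f (x, a₂, a₃, a₄)) :=
    hf.comp (contMDiff_id.prodMk contMDiff_const)
  rw [hγ.flowDeriv_slotFlow_zero hf]
  refine (Eq.trans ?_ (hγ.hasDerivAt_inv hu a₁).deriv)
  simp only [flowDeriv, slotFlow, slot, Prod.mk_mul_mk, mul_one]
  congr 1
  funext s
  rw [(hinv a₁ a₂ (a₃ * γ s) a₄ (γ s)⁻¹).1, mul_inv_cancel_right]

theorem HasVelocity.flowDeriv_slotFlow_three (hγ : HasVelocity γ X) {f : K × K × K × K → ℂ}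
    (hf : ContMDiff (I.prod (I.prod (I.prod I))) 𝓘(ℝ, ℂ) ∞ f) (hinv : ExtendedGaugeInvariant f)
    (a : K × K × K × K) : flowDeriv (slotFlow γ 3) f a = -flowDeriv (slotFlow γ 1) f a := by
  obtain ⟨a₁, a₂, a₃, a₄⟩ := a
  have hu : ContMDiff I 𝓘(ℝ, ℂ) ∞ (fun x => f (a₁, x, a₃, a₄)) :=
    hf.comp (contMDiff_const.prodMk (contMDiff_id.prodMk contMDiff_const))
  rw [hγ.flowDeriv_slotFlow_one hf]
  refine (Eq.trans ?_ (hγ.hasDerivAt_inv hu a₂).deriv)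
  simp only [flowDeriv, slotFlow, slot, Prod.mk_mul_mk, mul_one]
  congr 1
  funext s
  rw [(hinv a₁ a₂ a₃ (a₄ * γ s) (γ s)⁻¹).2, mul_inv_cancel_right]

variable {α : Fin 4 → K} {u : K → ℝ}

theorem HasVelocity.flowDeriv_holonomy_self (hγ : HasVelocity γ X)
    (hu : ContMDiff I 𝓘(ℝ, ℝ) ∞ u) (i : Fin 4) :
    flowDeriv (slotFlow γ i) (fun a => u (holonomy α i a))
      = fun a => leftInvDeriv X u (holonomy α i a) := by
  funext a
  rw [← hγ.flowDeriv_eq hu]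
  simp only [flowDeriv, slotFlow, holonomy_mul_slot, if_true]

/-- The translation puts `(γ s)⁻¹` on the left of the holonomy. For a class function it may be moved
to the right, where it gives minus the left-invariant derivative. -/
theorem HasVelocity.flowDeriv_holonomy_succ (hγ : HasVelocity γ X)
    (hu : ContMDiff I 𝓘(ℝ, ℝ) ∞ u) (hconj : ∀ k x, u (k * x * k⁻¹) = u x) {i j : Fin 4}
    (hij : j = i + 1) (a : K × K × K × K) :
    flowDeriv (slotFlow γ j) (fun a => u (holonomy α i a)) a
      = -leftInvDeriv X u (holonomy α i a) := by
  rw [← (hγ.hasDerivAt_inv hu (holonomy α i a)).deriv]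
  have hne : j ≠ i := by rw [hij]; fin_cases i <;> decide
  simp only [flowDeriv, slotFlow, holonomy_mul_slot, if_neg hne, if_pos hij]
  congr 1
  funext s
  rw [← hconj (γ s), mul_inv_cancel_left]

theorem gradDotGrad₁₂_eq {ι : Type*} [Fintype ι] {X : Module.Basis ι ℝ (GroupLieAlgebra I K)}
    {γ : ι → ℝ → K} (hγ : ∀ i, HasVelocity (γ i) (X i)) {f : K × K × K × K → ℂ}
    (hf : ContMDiff (I.prod (I.prod (I.prod I))) 𝓘(ℝ, ℂ) ∞ f) (a : K × K × K × K) :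
    gradDotGrad₁₂ X f a
      = ∑ i, flowDeriv (slotFlow (γ i) 0) (flowDeriv (slotFlow (γ i) 1) f) a := by
  obtain ⟨a₁, a₂, a₃, a₄⟩ := a
  refine Finset.sum_congr rfl fun i _ => ?_
  rw [(hγ i).flowDeriv_slotFlow_zero
    (((hγ i).isSmoothFamily_slotFlow 1).contMDiff_flowDeriv hf)]
  congr 1
  exact funext fun x => ((hγ i).flowDeriv_slotFlow_one hf x a₂ a₃ a₄).symm

end FourFold

/-! ### Time derivatives of the integral. -/

section TimeDerivative

variable {E : Type*} [NormedAddCommGroup E] [NormedSpace ℝ E]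
  {H : Type*} [TopologicalSpace H] {I : ModelWithCorners ℝ E H}
  {K : Type*} [TopologicalSpace K] [ChartedSpace H K] [Group K] [MeasurableSpace K]
  {dx : Measure K} [IsProbabilityMeasure dx] {f : K × K × K × K → ℂ}
  {ι : Type*} [Fintype ι] {X : Module.Basis ι ℝ (GroupLieAlgebra I K)} {ρ : ℝ → K → ℝ}

instance isProbabilityMeasure_haar4 : IsProbabilityMeasure (haar4 dx) := by
  unfold haar4; infer_instance

variable [LieGroup I ∞ K] [SecondCountableTopology K] [CompactSpace K] [BorelSpace K]

theorem IsHeatKernel.hasDerivAt_muIntegral (hρ : IsHeatKernel X dx ρ) (hf : Continuous f)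
    (α : Fin 4 → K) {t : Fin 4 → ℝ} (ht : ∀ i, 0 < t i) (i : Fin 4) :
    HasDerivAt (fun s : ℝ => muIntegral dx ρ α (Function.update t i s) f)
      (∫ a, ((1 / 2 : ℝ) * laplacian X (ρ (t i)) (holonomy α i a) *
        ∏ j ∈ Finset.univ.erase i, ρ (t j) (holonomy α j a)) • f a ∂(haar4 dx)) (t i) := by
  have hh := fun i => (contMDiff_holonomy (I := I) α i).continuous
  have hr : ∀ j, Continuous (ρ (t j)) := fun j => (hρ.contMDiff (ht j)).continuous
  have he : (fun s : ℝ => muIntegral dx ρ α (Function.update t i s) f)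
      = fun s => ∫ a, (ρ s (holonomy α i a) *
        ∏ j ∈ Finset.univ.erase i, ρ (t j) (holonomy α j a)) • f a ∂(haar4 dx) := by
    funext s
    refine integral_congr_ae (Eventually.of_forall fun a => ?_)
    beta_reduce
    rw [density_eq_prod, ← Finset.mul_prod_erase _ _ (Finset.mem_univ i), Function.update_self]
    congr 2
    refine Finset.prod_congr rfl fun j hj => ?_
    rw [Function.update_of_ne (Finset.ne_of_mem_erase hj)]
  rw [he]
  refine hasDerivAt_integral_of_compact (haar4 dx)
    (U' := fun s a => ((1 / 2 : ℝ) * laplacian X (ρ s) (holonomy α i a) *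
        ∏ j ∈ Finset.univ.erase i, ρ (t j) (holonomy α j a)) • f a)
    (isOpen_Ioi.mem_nhds (ht i)) (fun s hs => ?_) (fun s hs a => ?_) ?_
  · have := (hρ.contMDiff hs).continuous
    fun_prop
  · exact ((hρ.heat_equation s hs _).mul_const _).smul_const _
  · have h1 : ContinuousOn (fun p : ℝ × (K × K × K × K) => laplacian X (ρ p.1) (holonomy α i p.2))
        (Set.Ioi 0 ×ˢ Set.univ) :=
      hρ.continuousOn_laplacian.comp
        (f := fun p : ℝ × (K × K × K × K) => (p.1, holonomy α i p.2)) (by fun_prop)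
        (fun p hp => ⟨hp.1, trivial⟩)
    fun_prop

end TimeDerivative

/-! ### Symmetrised integration by parts and cancellation of the cross terms. -/

section FourFoldIntegral

variable {E : Type*} [NormedAddCommGroup E] [NormedSpace ℝ E]
  {H : Type*} [TopologicalSpace H] {I : ModelWithCorners ℝ E H}
  {K : Type*} [TopologicalSpace K] [ChartedSpace H K] [Group K] [LieGroup I ∞ K]
  [IsTopologicalGroup K] [SecondCountableTopology K] [CompactSpace K] [MeasurableSpace K]
  [BorelSpace K] {dx : Measure K} [dx.IsHaarMeasure] [IsProbabilityMeasure dx]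
  {f : K × K × K × K → ℂ}

theorem integral_slotFlow (γ : ℝ → K) (j : Fin 4) (s : ℝ) (v : K × K × K × K → ℂ) :
    ∫ a, v (slotFlow γ j s a) ∂(haar4 dx) = ∫ a, v a ∂(haar4 dx) := by
  have := isMulRightInvariant_of_compactSpace dx
  have : (dx.prod (dx.prod dx)).IsMulRightInvariant :=
    haveI : (dx.prod dx).IsMulRightInvariant := inferInstance
    inferInstance
  have : (haar4 dx).IsMulRightInvariant := by unfold haar4; infer_instance
  exact integral_mul_right_eq_self v (slot j (γ s))

/-- The mixed second derivative in the first two variables, integrated against a density built from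
class functions, turns into second derivatives of the factors of the density. -/
theorem two_mul_integral_flowDeriv_flowDeriv {γ : ℝ → K} {X : GroupLieAlgebra I K}
    (hγ : HasVelocity γ X) (hf : ContMDiff (I.prod (I.prod (I.prod I))) 𝓘(ℝ, ℂ) ∞ f)
    (hinv : ExtendedGaugeInvariant f) (α : Fin 4 → K) {r : Fin 4 → K → ℝ}
    (hr : ∀ i, ContMDiff I 𝓘(ℝ, ℝ) ∞ (r i))
    (hL : ∀ i, ContMDiff I 𝓘(ℝ, ℝ) ∞ (leftInvDeriv X (r i)))
    (hLL : ∀ i, Continuous (leftInvDeriv X (leftInvDeriv X (r i))))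
    (hconj : ∀ i k x, r i (k * x * k⁻¹) = r i x) :
    2 * ∫ a, (∏ i, r i (holonomy α i a)) •
        flowDeriv (slotFlow γ 0) (flowDeriv (slotFlow γ 1) f) a ∂(haar4 dx)
      = ∫ a, (-∑ i : Fin 4, (-1 : ℝ) ^ (i : ℕ) *
          (leftInvDeriv X (leftInvDeriv X (r i)) (holonomy α i a) *
            ∏ j ∈ Finset.univ.erase i, r j (holonomy α j a))) • f a ∂(haar4 dx) := by
  have : IsManifold I ∞ K := inferInstance
  have hT := fun j => hγ.isSmoothFamily_slotFlow j
  have hμ := fun (j : Fin 4) (s : ℝ) (v : K × K × K × K → ℂ) (_ : Continuous v) =>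
    integral_slotFlow (dx := dx) γ j s v
  have hρ := fun i => (hr i).comp (contMDiff_holonomy (I := I) α i)
  have hself := fun i => hγ.flowDeriv_holonomy_self (α := α) (hr i) i
  have hself' := fun i => hγ.flowDeriv_holonomy_self (α := α) (hL i) i
  have hsucc := fun {i j : Fin 4} (h : j = i + 1) =>
    hγ.flowDeriv_holonomy_succ (α := α) (hr i) (hconj i) h
  have hf20 := hγ.flowDeriv_slotFlow_two hf hinv
  have hf31 := hγ.flowDeriv_slotFlow_three hf hinv
  have hf13 : ∀ a, flowDeriv (slotFlow γ 1) f a = -flowDeriv (slotFlow γ 3) f a :=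
    fun a => by rw [hf31, neg_neg]
  have e1 := integral_mul₄_smul_flowDeriv_flowDeriv (hT 0) (hT 1) (hT 3) (hμ 0) (hμ 1) (hμ 3)
    (slotFlow_comm γ (by decide)) hf hf13 (hρ 0) (hρ 1) (hρ 2) (hρ 3) (hself 0)
    (flowDeriv_holonomy_of_ne (by decide) (by decide))
    (flowDeriv_holonomy_of_ne (by decide) (by decide)) (hsucc (by decide)) (hsucc (by decide))
    (congrFun (hself 1)) (flowDeriv_holonomy_of_ne (by decide) (by decide))
    (flowDeriv_holonomy_of_ne (by decide) (by decide))
    (flowDeriv_holonomy_of_ne (by decide) (by decide))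
    (flowDeriv_holonomy_of_ne (by decide) (by decide)) (hsucc (by decide)) (hself 3)
  -- The same identity with all indices shifted by 2: its cross terms are the negatives of those in
  -- `e1`.
  have e2 := integral_mul₄_smul_flowDeriv_flowDeriv (hT 2) (hT 3) (hT 1) (hμ 2) (hμ 3) (hμ 1)
    (slotFlow_comm γ (by decide)) hf hf31 (hρ 2) (hρ 3) (hρ 0) (hρ 1) (hself 2)
    (flowDeriv_holonomy_of_ne (by decide) (by decide))
    (flowDeriv_holonomy_of_ne (by decide) (by decide)) (hsucc (by decide)) (hsucc (by decide))
    (congrFun (hself 3)) (flowDeriv_holonomy_of_ne (by decide) (by decide))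
    (flowDeriv_holonomy_of_ne (by decide) (by decide))
    (flowDeriv_holonomy_of_ne (by decide) (by decide))
    (flowDeriv_holonomy_of_ne (by decide) (by decide)) (hsucc (by decide)) (hself 1)
  -- Both gauge relations contribute a sign and the slot flows commute, so the two mixed derivatives
  -- of `f` agree.
  have hff : flowDeriv (slotFlow γ 2) (flowDeriv (slotFlow γ 3) f)
      = flowDeriv (slotFlow γ 0) (flowDeriv (slotFlow γ 1) f) := by
    rw [funext hf31, flowDeriv_neg,
      flowDeriv_comm (hT 2) (hT 1) hf (slotFlow_comm γ (by decide)), funext hf20, flowDeriv_neg,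
      flowDeriv_comm (hT 1) (hT 0) hf (slotFlow_comm γ (by decide))]
    simp
  rw [hff] at e2
  rw [hself' 0, hself' 3] at e1
  rw [hself' 2, hself' 1] at e2
  have hh := fun i => (contMDiff_holonomy (I := I) α i).continuous
  have hLc := fun i => (hL i).continuous
  have hrc := fun i => (hr i).continuous
  have hcf := hf.continuous
  simp only [Function.comp_def] at e1 e2
  rw [two_mul]
  -- Only the second copy of the integral is reordered, to match the rotated product in `e2`.
  conv_lhs => enter [2]; rw [show (fun a => (∏ i, r i (holonomy α i a)) •
    flowDeriv (slotFlow γ 0) (flowDeriv (slotFlow γ 1) f) a) = fun a =>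
      (r 2 (holonomy α 2 a) * r 3 (holonomy α 3 a) * r 0 (holonomy α 0 a) * r 1 (holonomy α 1 a)) •
        flowDeriv (slotFlow γ 0) (flowDeriv (slotFlow γ 1) f) a from funext fun a => by
          rw [Fin.prod_univ_four]; congr 1; ring]
  simp only [Fin.prod_univ_four]
  rw [e1, e2, ← integral_add (integrable_of_continuous (by fun_prop))
    (integrable_of_continuous (by fun_prop))]
  refine integral_congr_ae (Eventually.of_forall fun a => ?_)
  beta_reduce
  rw [← add_smul]
  congr 1
  rw [Fin.sum_univ_four, show Finset.univ.erase (0 : Fin 4) = {1, 2, 3} from by decide,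
    show Finset.univ.erase (1 : Fin 4) = {0, 2, 3} from by decide,
    show Finset.univ.erase (2 : Fin 4) = {0, 1, 3} from by decide,
    show Finset.univ.erase (3 : Fin 4) = {0, 1, 2} from by decide]
  simp
  ring

variable {ι : Type*} [Fintype ι] {X : Module.Basis ι ℝ (GroupLieAlgebra I K)} {ρ : ℝ → K → ℝ}

variable [I.Boundaryless]

/-- The mixed gradient integrated against the heat kernel density, in terms of Laplacians of the
heat kernels. -/
theorem IsHeatKernel.two_mul_muIntegral_gradDotGrad₁₂ (hρ : IsHeatKernel X dx ρ)
    (hconj : ∀ t, 0 < t → ∀ k x, ρ t (k * x * k⁻¹) = ρ t x)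
    (hf : ContMDiff (I.prod (I.prod (I.prod I))) 𝓘(ℝ, ℂ) ∞ f)
    (hinv : ExtendedGaugeInvariant f) (α : Fin 4 → K) {t : Fin 4 → ℝ} (ht : ∀ i, 0 < t i) :
    2 * muIntegral dx ρ α t (gradDotGrad₁₂ X f)
      = ∫ a, (-∑ i : Fin 4, (-1 : ℝ) ^ (i : ℕ) * (laplacian X (ρ (t i)) (holonomy α i a) *
          ∏ j ∈ Finset.univ.erase i, ρ (t j) (holonomy α j a))) • f a ∂(haar4 dx) := by
  have : IsManifold I ∞ K := inferInstance
  choose γ hγ using fun i => exists_hasVelocity (I := I) (X i)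
  have hh := fun i => (contMDiff_holonomy (I := I) α i).continuous
  have hr : ∀ j, ContMDiff I 𝓘(ℝ, ℝ) ∞ (ρ (t j)) := fun j => hρ.contMDiff (ht j)
  have hrc := fun j => (hr j).continuous
  have hL := fun i j => contMDiff_leftInvDeriv (X i) (hr j)
  have hLL := fun i j => (contMDiff_leftInvDeriv (X i) (hL i j)).continuous
  have hff := fun i => (((hγ i).isSmoothFamily_slotFlow 0).contMDiff_flowDeriv
    (((hγ i).isSmoothFamily_slotFlow 1).contMDiff_flowDeriv hf)).continuous
  have hfc := hf.continuous
  simp only [muIntegral, density_eq_prod, gradDotGrad₁₂_eq hγ hf, Finset.smul_sum]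
  rw [integral_finsetSum _ fun i _ => integrable_of_continuous (by fun_prop), Finset.mul_sum,
    Finset.sum_congr rfl fun i _ => two_mul_integral_flowDeriv_flowDeriv (hγ i) hf hinv α hr
      (hL i) (hLL i) (fun j => hconj _ (ht j)),
    ← integral_finsetSum _ fun i _ => integrable_of_continuous (by fun_prop)]
  refine integral_congr_ae (Eventually.of_forall fun a => ?_)
  beta_reduce
  rw [← Finset.sum_smul, Finset.sum_neg_distrib, Finset.sum_comm]
  simp only [laplacian, Finset.sum_mul, Finset.mul_sum]

end FourFoldIntegral

end MakeenkoMigdal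

end

/-- **Local abstract Makeenko–Migdal equation.** `K` is a compact Lie group with a bi-invariant
metric `g`, `dx` is its normalized Haar measure, `X` is an orthonormal basis of its Lie algebra,
and `ρ` is its heat kernel. -/
theorem theorem3
    {E : Type*} [NormedAddCommGroup E] [NormedSpace ℝ E] [FiniteDimensional ℝ E]
    {H : Type*} [TopologicalSpace H] (I : ModelWithCorners ℝ E H) [I.Boundaryless]
    {K : Type*} [TopologicalSpace K] [ChartedSpace H K] [Group K] [LieGroup I ∞ K]
    [CompactSpace K] [T2Space K] [MeasurableSpace K] [BorelSpace K]
    (g : Bundle.ContMDiffRiemannianMetric I ∞ E (fun x : K => TangentSpace I x))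
    (hg : MakeenkoMigdal.IsBiInvariant g)
    {ι : Type*} [Fintype ι] [DecidableEq ι] (X : Module.Basis ι ℝ (GroupLieAlgebra I K))
    (hX : MakeenkoMigdal.IsOrthonormalFor g X)
    (dx : Measure K) [dx.IsHaarMeasure] [IsProbabilityMeasure dx]
    (ρ : ℝ → K → ℝ) (hρ : MakeenkoMigdal.IsHeatKernel X dx ρ)
    (f : K × K × K × K → ℂ)
    (hf : ContMDiff (I.prod (I.prod (I.prod I))) 𝓘(ℝ, ℂ) ∞ f)
    (hinv : MakeenkoMigdal.ExtendedGaugeInvariant f)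
    (α : Fin 4 → K) (t : Fin 4 → ℝ) (ht : ∀ i, 0 < t i) :
    Integrable (fun a => MakeenkoMigdal.density ρ α t a • f a) (MakeenkoMigdal.haar4 dx) ∧
    Integrable (fun a => MakeenkoMigdal.density ρ α t a • MakeenkoMigdal.gradDotGrad₁₂ X f a)
      (MakeenkoMigdal.haar4 dx) ∧
    ∃ D : Fin 4 → ℂ,
      (∀ i, HasDerivAt
        (fun s : ℝ => MakeenkoMigdal.muIntegral dx ρ α (Function.update t i s) f) (D i) (t i)) ∧
      D 0 - D 1 + D 2 - D 3
        = - MakeenkoMigdal.muIntegral dx ρ α t (MakeenkoMigdal.gradDotGrad₁₂ X f) := by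
  have : IsManifold I ∞ K := inferInstance
  have : IsTopologicalGroup K := topologicalGroup_of_lieGroup I ∞
  -- Second countability of `K` makes the product σ-algebra on the fourfold product the Borel one,
  -- so that continuous functions there are measurable.
  have := I.secondCountableTopology
  have : SecondCountableTopology K := ChartedSpace.secondCountable_of_sigmaCompact H K
  have hconj := fun (s : ℝ) (hs : 0 < s) => hρ.conj_eq hg hX hs
  have hh := fun i => (MakeenkoMigdal.contMDiff_holonomy (I := I) α i).continuous
  have hrc := fun i => (hρ.contMDiff (ht i)).continuous
  have hlc := fun i => (MakeenkoMigdal.contMDiff_laplacian X (hρ.contMDiff (ht i))).continuous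
  have hfc := hf.continuous
  have hgrad : Continuous (MakeenkoMigdal.gradDotGrad₁₂ X f) := by
    choose γ hγ using fun i => MakeenkoMigdal.exists_hasVelocity (I := I) (X i)
    have hff := fun i => (((hγ i).isSmoothFamily_slotFlow 0).contMDiff_flowDeriv
      (((hγ i).isSmoothFamily_slotFlow 1).contMDiff_flowDeriv hf)).continuous
    rw [funext fun a => MakeenkoMigdal.gradDotGrad₁₂_eq hγ hf a]
    fun_prop
  have hdens : Continuous (MakeenkoMigdal.density ρ α t) := by
    rw [funext fun a => MakeenkoMigdal.density_eq_prod ρ α t a]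
    fun_prop
  refine ⟨MakeenkoMigdal.integrable_of_continuous (by fun_prop),
    MakeenkoMigdal.integrable_of_continuous (by fun_prop), _,
    fun i => hρ.hasDerivAt_muIntegral hfc α ht i, ?_⟩
  -- The factor 2 here matches the `1 / 2` in the heat equation, so the claim is doubled and reduced
  -- to a pointwise identity of integrands.
  have key := hρ.two_mul_muIntegral_gradDotGrad₁₂ hconj hf hinv α ht
  rw [← integral_sub (MakeenkoMigdal.integrable_of_continuous (by fun_prop))
      (MakeenkoMigdal.integrable_of_continuous (by fun_prop)),
    ← integral_add (MakeenkoMigdal.integrable_of_continuous (by fun_prop))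
      (MakeenkoMigdal.integrable_of_continuous (by fun_prop)),
    ← integral_sub (MakeenkoMigdal.integrable_of_continuous (by fun_prop))
      (MakeenkoMigdal.integrable_of_continuous (by fun_prop)),
    eq_neg_iff_add_eq_zero, ← mul_right_inj' (two_ne_zero' ℂ), mul_add, key, mul_zero,
    ← integral_const_mul,
    ← integral_add (MakeenkoMigdal.integrable_of_continuous (by fun_prop))
      (MakeenkoMigdal.integrable_of_continuous (by fun_prop))]
  refine (integral_congr_ae (Eventually.of_forall fun a => ?_)).trans (integral_zero _ _)
  simp only [Fin.sum_univ_four, Complex.real_smul]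
  push_cast
  simp only [Fin.coe_ofNat_eq_mod]
  norm_num
  ring
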